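/- **Setting.** Let $K\subset\mathbb R^n$ be convex, contain a ball of positive radius centred at the origin and be contained in the ball of radius $R$ about the origin; let $p\in\mathbb R^n\setminus\{0\}$, $\delta>0$, $\tilde\delta>0$, and let $r,u$ be real parameters. Let $\rho_0,\sigma_0,\gamma_0,\nu$ be constants. Consider the following cutting-plane algorithm. For a finite family of cuts $(a_i,b_i)$, $1\le i\le h$, with attached numbers $\kappa(a_i,b_i)>0$, let $P=\{x:\|x\|\le1\}\cap\bigcap_i\{x:a_i^Tx\ge b_i\}$, and on the interior of $P$ (the set where $\|x\|<1$ and $a_i^Tx>b_i$ for all $i$) put $$F(x)=-\sum_{i=1}^h\ln(a_i^Tx-b_i)-\ln(1-x^Tx),\qquad N(x)=F(x)+\sum_{i=1}^h\ln\kappa(a_i,b_i),$$ $$\sigma_i(x)=\frac{a_i^T(\nabla^2F(x))^{-1}a_i}{(a_i^Tx-b_i)^2},\qquad \mu_i(x)=\frac{a_i^Tx-b_i}{\kappa(a_i,b_i)},\qquad \lambda(x)=\sqrt{\nabla F(x)^T(\nabla^2F(x))^{-1}\nabla F(x)}.$$ The analytic centre $\omega$ of $P$ is the unique minimiser of $F$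 over the interior of $P$. Let $q_t=1-(1-3t)^{1/3}$ and $\zeta_0=q_{\rho_0}$. *Recentring at $z$* means replacing $z$ by one of the Newton iterates $x_0=z$, $x_{i+1}=x_i-\varsigma_i(\nabla^2F(x_i))^{-1}\nabla F(x_i)$, with $\varsigma_i=(1+\lambda(x_i))^{-1}$ if $\lambda(x_i)\ge2-\sqrt3$ and $\varsigma_i=1$ otherwise, at which both $\lambda(x_i)<\rho_0$ and $q_{\lambda(x_i)}<\frac{\tilde\delta}{1+\tilde\delta}\frac{\|x_i\|}{\sqrt2}$ (for instance the first such iterate). *Initialisation:* the single cut $a_1=p/\|p\|$, $b_1=0$, with $\kappa(a_1,b_1)=1/\sqrt3$, and $z=a_1/\sqrt3$. *Iteration:* 1. If some $j$ has $\mu_j(z)>2$ and $\sigma_j(z)<\sigma_0$, discard one such cut $(a_j,b_j)$ and recentre at $z$ for the new $F$. 2. Otherwise, if some $j$ has $\mu_j(z)>2$, choose one such $j$ and reset $\kappa(a_j,b_j):=a_j^Tz-b_j$. 3. Otherwise (all $\mu_i(z)\le2$) put $c=z/\|z\|$ and let $k$ be any answer of the weak optimisation oracle for $K$ with accuracy $\epsilon=\delta/5$,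 that is, $k$ has distance at most $\epsilon$ from some point of $K$ and $c^Tx\le c^Tk+\epsilon$ for all $x\in K$. If $c^Tp\ge c^Tk+\delta/5$, the algorithm returns $c$ and ends. Otherwise let $\bar a=(p-k)-c^T(p-k)\,c$ (assumed nonzero), $a=\bar a/\|\bar a\|$, choose $\beta<0$ with $a^T(\nabla^2F(z))^{-1}a/(a^Tz-\beta)^2=\gamma_0^2$, add the cut $(a,\beta)$, recentre at $z$ for the new $F$ to get $z_{\mathrm a}$, and set $\kappa(a,\beta):=a^Tz_{\mathrm a}-\beta$. After each iteration the loop ends if $h\ge\nu nu$ or $2r>\frac{\min_i(a_i^Tz-b_i)}{1-\zeta_0}(3h+4)$. **Constants.** Assume $0<\rho_0<\frac13$, $\sigma_0>0$, $\gamma_0>0$, $\zeta_0<0.02$, $\sigma_0/(1-\zeta_0)^4<1$, $C_3<\frac13$, $C_4<0.615$, $C_5<1$ and $C_6>\zeta_0$, where $$C_3=\sqrt{\frac{\sigma_0/(1-\zeta_0)^4}{1-\sigma_0/(1-\zeta_0)^4}},\quad C_4=\frac12q_{C_3}^2\,\frac{1+q_{C_3}}{1-q_{C_3}},\quad C_5=\frac{1-\zeta_0}{1/\gamma_0+2+\zeta_0},\quad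 C_6=\frac12C_5^2-\frac{C_5^3}{3(1-C_5)}.$$ (For example $\rho_0=0.001$, $\sigma_0=0.08$, $\gamma_0=0.25$.) **Theorem.** There is a constant $\theta>0$, depending only on the constants of the algorithm and in particular independent of $h,n,R,\delta$ (and of $K,p,r,u,\tilde\delta$ and the oracle's answers), such that in every run of the algorithm, after $\iota$ completed iterations, $P$ has a unique analytic centre $\omega$ and $N(\omega)\ge\theta\iota$. -/

import Mathlib

namespace AnalyticCentre

/-- `ℝⁿ` with the Euclidean norm. -/
abbrev Vec (n : ℕ) := EuclideanSpace ℝ (Fin n)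

/-- A cutting plane `{x : aᵀx = b}`, together with its current value `κ(a, b)`. -/
structure Cut (n : ℕ) where
  a : Vec n
  b : ℝ
  kap : ℝ

noncomputable section

/-- `aᵀx - b`. -/
def Cut.slack {n : ℕ} (e : Cut n) (x : Vec n) : ℝ := inner ℝ e.a x - e.b

/-- `μ(x) = (aᵀx - b) / κ(a, b)`. -/
def Cut.mu {n : ℕ} (e : Cut n) (x : Vec n) : ℝ := e.slack x / e.kap

/-- The interior of the search region `P = Bₙ ∩ ⋂ᵢ {x : aᵢᵀx ≥ bᵢ}`, that is, the domain of the
barrier. The cuts are an unordered family, counted with multiplicity; `h` is its cardinality. -/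
def region {n : ℕ} (S : Multiset (Cut n)) : Set (Vec n) :=
  {x | ‖x‖ < 1 ∧ ∀ e ∈ S, 0 < e.slack x}

/-- `F(x) = -∑ᵢ ln(aᵢᵀx - bᵢ) - ln(1 - xᵀx)`. -/
def barrier {n : ℕ} (S : Multiset (Cut n)) (x : Vec n) : ℝ :=
  -(S.map fun e => Real.log (e.slack x)).sum - Real.log (1 - ‖x‖ ^ 2)

/-- `∇F(x) = -∑ᵢ aᵢ/(aᵢᵀx - bᵢ) + 2x/(1 - xᵀx)`. -/
def grad {n : ℕ} (S : Multiset (Cut n)) (x : Vec n) : Vec n :=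
  -(S.map fun e => (e.slack x)⁻¹ • e.a).sum + (2 / (1 - ‖x‖ ^ 2)) • x

/-- `∇²F(x) = ∑ᵢ aᵢaᵢᵀ/(aᵢᵀx - bᵢ)² + 4xxᵀ/(1 - xᵀx)² + 2I/(1 - xᵀx)`. -/
def hess {n : ℕ} (S : Multiset (Cut n)) (x : Vec n) : Vec n →L[ℝ] Vec n :=
  (S.map fun e => (1 / e.slack x ^ 2) • InnerProductSpace.rankOne ℝ e.a e.a).sum
    + (4 / (1 - ‖x‖ ^ 2) ^ 2) • InnerProductSpace.rankOne ℝ x x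
    + (2 / (1 - ‖x‖ ^ 2)) • ContinuousLinearMap.id ℝ (Vec n)

/-- `(∇²F(x))⁻¹`. -/
def hessInv {n : ℕ} (S : Multiset (Cut n)) (x : Vec n) : Vec n →L[ℝ] Vec n :=
  (hess S x).inverse

/-- `σ(x) = aᵀ(∇²F(x))⁻¹a / (aᵀx - b)²`. -/
def sigma {n : ℕ} (S : Multiset (Cut n)) (e : Cut n) (x : Vec n) : ℝ :=
  inner ℝ e.a (hessInv S x e.a) / e.slack x ^ 2

/-- `λ(x) = √(∇F(x)ᵀ (∇²F(x))⁻¹ ∇F(x))`. -/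
def lam {n : ℕ} (S : Multiset (Cut n)) (x : Vec n) : ℝ :=
  √(inner ℝ (grad S x) (hessInv S x (grad S x)))

/-- `q_t = 1 - (1 - 3t)^{1/3}` (only used for `t < 1/3`). -/
def q (t : ℝ) : ℝ := 1 - (1 - 3 * t) ^ (1 / 3 : ℝ)

/-- `ω` is an analytic centre of the region: a minimiser of `F` over the domain of `F`. -/
def IsCentre {n : ℕ} (S : Multiset (Cut n)) (w : Vec n) : Prop :=
  w ∈ region S ∧ ∀ x ∈ region S, barrier S w ≤ barrier S x

/-- The potential `N(x) = F(x) + ∑ᵢ ln κ(aᵢ, bᵢ)`. -/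
def potential {n : ℕ} (S : Multiset (Cut n)) (x : Vec n) : ℝ :=
  barrier S x + (S.map fun e => Real.log e.kap).sum

/-- One step of the damped Newton method; the damping is switched off below `2 - √3`. -/
def newtonStep {n : ℕ} (S : Multiset (Cut n)) (x : Vec n) : Vec n :=
  x - (if 2 - √3 ≤ lam S x then (1 + lam S x)⁻¹ else 1) • hessInv S x (grad S x)

/-- The numerical constants of the algorithm. -/
structure Constants where
  rho0 : ℝ
  sigma0 : ℝ
  gamma0 : ℝ
  nu : ℝ

/-- `ζ₀ = q_{ρ₀}`. -/
def Constants.zeta0 (c : Constants) : ℝ := q c.rho0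

/-- `C₃ = √(s/(1 - s))` with `s = σ₀/(1 - ζ₀)⁴`. -/
def Constants.C3 (c : Constants) : ℝ :=
  √((c.sigma0 / (1 - c.zeta0) ^ 4) / (1 - c.sigma0 / (1 - c.zeta0) ^ 4))

def Constants.C4 (c : Constants) : ℝ := 1 / 2 * q c.C3 ^ 2 * ((1 + q c.C3) / (1 - q c.C3))

def Constants.C5 (c : Constants) : ℝ := (1 - c.zeta0) / (1 / c.gamma0 + 2 + c.zeta0)

def Constants.C6 (c : Constants) : ℝ := 1 / 2 * c.C5 ^ 2 - c.C5 ^ 3 / (3 * (1 - c.C5))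

/-- The conditions on the constants. -/
structure Constants.Admissible (c : Constants) : Prop where
  rho0_pos : 0 < c.rho0
  rho0_lt : c.rho0 < 1 / 3
  sigma0_pos : 0 < c.sigma0
  gamma0_pos : 0 < c.gamma0
  zeta0_lt : c.zeta0 < 0.02
  sigma0_lt : c.sigma0 / (1 - c.zeta0) ^ 4 < 1
  C3_lt : c.C3 < 1 / 3
  C4_lt : c.C4 < 0.615
  C5_lt : c.C5 < 1
  C6_gt : c.zeta0 < c.C6

/-- The data of one call of the algorithm: the convex set `K`, the point `p`, the accuracy `δ`,
and the parameters `r`, `u` (stopping conditions) and `δ̃` (Newton termination). -/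
structure Problem (n : ℕ) where
  K : Set (Vec n)
  p : Vec n
  del : ℝ
  r : ℝ
  u : ℝ
  delTilde : ℝ

/-- `y` is a legal answer of the weak optimisation oracle for `K` to the query `c` with
accuracy `ε`: `y ∈ S(K, ε)` and `cᵀx ≤ cᵀy + ε` for all `x ∈ K`. -/
def IsWOptAnswer {n : ℕ} (K : Set (Vec n)) (c : Vec n) (eps : ℝ) (y : Vec n) : Prop :=
  (∃ x ∈ K, ‖y - x‖ ≤ eps) ∧ ∀ x ∈ K, inner ℝ c x ≤ inner ℝ c y + eps

/-- The current cutting planes and the current approximate centre `z`. -/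
structure State (n : ℕ) where
  cuts : Multiset (Cut n)
  z : Vec n

/-- `a₁ = p/‖p‖`, `b₁ = 0`, `z = a₁/√3`, `κ(a₁, b₁) = 1/√3`. -/
def initial {n : ℕ} (I : Problem n) : State n where
  cuts := {⟨‖I.p‖⁻¹ • I.p, 0, 1 / √3⟩}
  z := (1 / √3) • (‖I.p‖⁻¹ • I.p)

/-- `z'` is a Newton iterate, started at `z`, for the barrier of the cuts `S`, at which both
termination conditions of the Newton loop hold. -/
def Recentred {n : ℕ} (c : Constants) (I : Problem n) (S : Multiset (Cut n)) (z z' : Vec n) :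
    Prop :=
  (∃ i : ℕ, z' = (newtonStep S)^[i] z) ∧ lam S z' < c.rho0 ∧
    q (lam S z') < I.delTilde / (1 + I.delTilde) * (‖z'‖ / √2)

/-- Subcase 1.1: a cut with `μ(z) > 2` and `σ(z) < σ₀` is discarded. -/
def DiscardStep {n : ℕ} (c : Constants) (I : Problem n) (s s' : State n) : Prop :=
  ∃ e : Cut n, s.cuts = e ::ₘ s'.cuts ∧ 2 < e.mu s.z ∧ sigma s.cuts e s.z < c.sigma0 ∧
    Recentred c I s'.cuts s.z s'.z

/-- Subcase 1.2: no cut can be discarded, and some cut with `μ(z) > 2` has its `κ` reset. -/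
def ResetStep {n : ℕ} (c : Constants) (s s' : State n) : Prop :=
  (∀ e ∈ s.cuts, 2 < e.mu s.z → c.sigma0 ≤ sigma s.cuts e s.z) ∧
  ∃ (e : Cut n) (T : Multiset (Cut n)), s.cuts = e ::ₘ T ∧ 2 < e.mu s.z ∧
    s'.cuts = ⟨e.a, e.b, e.slack s.z⟩ ::ₘ T ∧ s'.z = s.z

/-- The unnormalised new normal `(p - k) - cᵀ(p - k) c`. -/
def abar {n : ℕ} (p k c : Vec n) : Vec n := (p - k) - (inner ℝ c (p - k) : ℝ) • c

/-- Case 2, when the oracle answer `k` does not end the algorithm: a shifted cut is added. -/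
def AddStep {n : ℕ} (c : Constants) (I : Problem n) (s s' : State n) : Prop :=
  (∀ e ∈ s.cuts, e.mu s.z ≤ 2) ∧
  ∃ v k a : Vec n, ∃ be : ℝ,
    v = ‖s.z‖⁻¹ • s.z ∧
    IsWOptAnswer I.K v (I.del / 5) k ∧
    inner ℝ v I.p < inner ℝ v k + I.del / 5 ∧
    abar I.p k v ≠ 0 ∧ a = ‖abar I.p k v‖⁻¹ • abar I.p k v ∧
    be < 0 ∧ inner ℝ a (hessInv s.cuts s.z a) / (inner ℝ a s.z - be) ^ 2 = c.gamma0 ^ 2 ∧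
    s'.cuts = ⟨a, be, inner ℝ a s'.z - be⟩ ::ₘ s.cuts ∧
    Recentred c I s'.cuts s.z s'.z

/-- One complete pass through the body of the main loop. -/
def Iteration {n : ℕ} (c : Constants) (I : Problem n) (s s' : State n) : Prop :=
  DiscardStep c I s s' ∨ ResetStep c s s' ∨ AddStep c I s s'

/-- One of the two stopping conditions holds: `h ≥ ν n u`, or
`2r > minᵢ(aᵢᵀz - bᵢ)/(1 - ζ₀) · (3h + 4)`. -/
def Stopped {n : ℕ} (c : Constants) (I : Problem n) (s : State n) : Prop :=
  c.nu * n * I.u ≤ (s.cuts.card : ℝ) ∨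
  ∃ e ∈ s.cuts, e.slack s.z / (1 - c.zeta0) * (3 * (s.cuts.card : ℝ) + 4) < 2 * I.r

/-- `Reaches c I k s`: some run of the algorithm is in the state `s` after `k` iterations. The
stopping conditions are tested at the end of the loop body. -/
inductive Reaches {n : ℕ} (c : Constants) (I : Problem n) : ℕ → State n → Prop
  | init : Reaches c I 0 (initial I)
  | iterate {k : ℕ} {s s' : State n} : Reaches c I k s → (k = 0 ∨ ¬ Stopped c I s) →
      Iteration c I s s' → Reaches c I (k + 1) s'

end

theorem hasFDerivAt_log_slack {n : ℕ} (e : Cut n) (x : Vec n) (h : 0 < e.slack x) :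
    HasFDerivAt (fun y => Real.log (e.slack y)) ((e.slack x)⁻¹ • innerSL ℝ e.a) x := by
  have h1 : HasFDerivAt (fun y => e.slack y) (innerSL ℝ e.a) x := by
    simpa [Cut.slack] using ((innerSL ℝ e.a).hasFDerivAt (x := x)).sub_const e.b
  exact h1.log h.ne'

theorem hasFDerivAt_normSq {n : ℕ} (x : Vec n) :
    HasFDerivAt (fun y : Vec n => 1 - ‖y‖ ^ 2) (-((2 : ℝ) • innerSL ℝ x)) x := by
  have := ((hasStrictFDerivAt_norm_sq x).hasFDerivAt).const_sub 1
  simpa [two_smul] using this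

/-- On the domain of `F`, `grad` is the gradient of `barrier`. -/
theorem hasGradientAt_barrier {n : ℕ} (S : Multiset (Cut n)) (x : Vec n) (hx : x ∈ region S) :
    HasGradientAt (barrier S) (grad S x) x := by
  obtain ⟨hx1, hx2⟩ := hx
  have hpos : 0 < 1 - ‖x‖ ^ 2 := by nlinarith [norm_nonneg x]
  have hS : HasFDerivAt (fun y => (S.map fun e => Real.log (e.slack y)).sum)
      (innerSL ℝ (S.map fun e => (e.slack x)⁻¹ • e.a).sum) x := by
    induction S using Multiset.induction_on with
    | empty => simpa using hasFDerivAt_const (0 : ℝ) x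
    | cons e T ih =>
      have := (hasFDerivAt_log_slack e x (hx2 e (by simp))).add
        (ih fun f hf => hx2 f (by simp [hf]))
      simpa [Function.comp_def, Pi.add_def] using this
  rw [hasGradientAt_iff_hasFDerivAt]
  have := hS.neg.sub ((hasFDerivAt_normSq x).log hpos.ne')
  refine HasFDerivAt.congr_fderiv this ?_
  ext y
  simp [grad]
  ring

/-- On the domain of `F`, `hess` is the derivative of the gradient. -/
theorem hasFDerivAt_grad {n : ℕ} (S : Multiset (Cut n)) (x : Vec n) (hx : x ∈ region S) :
    HasFDerivAt (grad S) (hess S x) x := by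
  obtain ⟨hx1, hx2⟩ := hx
  have hpos : 0 < 1 - ‖x‖ ^ 2 := by nlinarith [norm_nonneg x]
  have hS : HasFDerivAt (fun y => (S.map fun e => (e.slack y)⁻¹ • e.a).sum)
      (-(S.map fun e => (1 / e.slack x ^ 2) • InnerProductSpace.rankOne ℝ e.a e.a).sum) x := by
    induction S using Multiset.induction_on with
    | empty => simpa using hasFDerivAt_const (0 : Vec n) x
    | cons e T ih =>
      have h0 := hx2 e (by simp)
      have h1 : HasFDerivAt (fun y => e.slack y) (innerSL ℝ e.a) x := by
        simpa [Cut.slack] using ((innerSL ℝ e.a).hasFDerivAt (x := x)).sub_const e.b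
      have h2 : HasFDerivAt (fun y => (e.slack y)⁻¹ • e.a) _ x :=
        ((hasDerivAt_inv h0.ne').comp_hasFDerivAt x h1).smul_const e.a
      have h3 := h2.add (ih fun f hf => hx2 f (by simp [hf]))
      simp only [Multiset.map_cons, Multiset.sum_cons]
      refine HasFDerivAt.congr_fderiv h3 ?_
      ext y
      simp [mul_smul]
      ring
  have hB : HasFDerivAt (fun y : Vec n => 2 / (1 - ‖y‖ ^ 2))
      ((4 / (1 - ‖x‖ ^ 2) ^ 2) • innerSL ℝ x) x := by
    have h1 := ((hasDerivAt_inv hpos.ne').comp_hasFDerivAt x (hasFDerivAt_normSq x)).const_mul 2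
    refine HasFDerivAt.congr_fderiv h1 ?_
    ext y
    simp
    ring
  have h := hS.neg.add (hB.smul (hasFDerivAt_id x))
  refine HasFDerivAt.congr_fderiv h ?_
  ext y
  simp [hess, smul_smul]
  ring

theorem q_le_of_cube_le {t v : ℝ} (hv : v ≤ 1) (h : (1 - v) ^ 3 ≤ 1 - 3 * t) : q t ≤ v := by
  have h1 : 0 ≤ 1 - v := by linarith
  have h2 : ((1 - v) ^ 3) ^ (1 / 3 : ℝ) ≤ (1 - 3 * t) ^ (1 / 3 : ℝ) :=
    Real.rpow_le_rpow (by positivity) h (by norm_num)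
  have h3 : ((1 - v) ^ 3) ^ (1 / 3 : ℝ) = 1 - v := by
    rw [← Real.rpow_natCast, ← Real.rpow_mul h1]
    norm_num
  rw [h3] at h2
  unfold q
  linarith

theorem q_nonneg {t : ℝ} (h0 : 0 ≤ t) (h1 : t ≤ 1 / 3) : 0 ≤ q t := by
  have : (1 - 3 * t) ^ (1 / 3 : ℝ) ≤ 1 :=
    Real.rpow_le_one (by linarith) (by linarith) (by norm_num)
  unfold q
  linarith

/-- The conditions on the constants are met by `ρ₀ = 0.001`, `σ₀ = 0.08`, `γ₀ = 0.25`
(and `ν = 1078`). -/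
theorem admissible_example :
    Constants.Admissible ⟨1 / 1000, 8 / 100, 1 / 4, 1078⟩ := by
  set c : Constants := ⟨1 / 1000, 8 / 100, 1 / 4, 1078⟩ with hc
  have hz0 : 0 ≤ c.zeta0 := q_nonneg (by norm_num [hc]) (by norm_num [hc])
  have hz1 : c.zeta0 ≤ 0.002 := q_le_of_cube_le (by norm_num) (by norm_num [hc])
  have hp : (0.99 : ℝ) ≤ (1 - c.zeta0) ^ 4 :=
    le_trans (by norm_num) (pow_le_pow_left₀ (by norm_num) (by linarith : 0.998 ≤ 1 - c.zeta0) 4)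
  have hs1 : c.sigma0 / (1 - c.zeta0) ^ 4 ≤ 0.081 := by
    rw [div_le_iff₀ (by linarith)]
    norm_num [hc] at hp ⊢
    linarith
  have hC3 : c.C3 ≤ 0.3 := by
    refine Real.sqrt_le_iff.mpr ⟨by norm_num, ?_⟩
    rw [div_le_iff₀ (by linarith)]
    linarith
  have hC30 : 0 ≤ c.C3 := Real.sqrt_nonneg _
  have hq0 : 0 ≤ q c.C3 := q_nonneg hC30 (by linarith)
  have hq1 : q c.C3 ≤ 0.54 := q_le_of_cube_le (by norm_num) (by norm_num; linarith)
  have hC4 : c.C4 < 0.615 := by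
    have h1 : (1 + q c.C3) / (1 - q c.C3) ≤ 3.35 := by
      rw [div_le_iff₀ (by linarith)]
      linarith
    have h2 : q c.C3 ^ 2 ≤ 0.54 ^ 2 := pow_le_pow_left₀ hq0 hq1 2
    have h3 : 0 ≤ (1 + q c.C3) / (1 - q c.C3) := div_nonneg (by linarith) (by linarith)
    unfold Constants.C4
    nlinarith [sq_nonneg (q c.C3)]
  have hC5l : 0.166 ≤ c.C5 := by
    unfold Constants.C5
    rw [le_div_iff₀ (by norm_num [hc]; positivity)]
    norm_num [hc] at hz1 ⊢
    linarith
  have hC5u : c.C5 ≤ 0.167 := by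
    unfold Constants.C5
    rw [div_le_iff₀ (by norm_num [hc]; positivity)]
    norm_num [hc] at hz0 ⊢
    linarith
  have hC6 : c.zeta0 < c.C6 := by
    have h1 : c.C5 ^ 3 / (3 * (1 - c.C5)) ≤ 0.002 := by
      rw [div_le_iff₀ (by linarith)]
      have : c.C5 ^ 3 ≤ 0.167 ^ 3 := pow_le_pow_left₀ (by linarith) hC5u 3
      norm_num at this ⊢
      linarith
    have h2 : 0.166 ^ 2 ≤ c.C5 ^ 2 := pow_le_pow_left₀ (by norm_num) hC5l 2
    unfold Constants.C6
    norm_num at h2 h1 hz1 ⊢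
    linarith
  exact ⟨by norm_num [hc], by norm_num [hc], by norm_num [hc], by norm_num [hc], by linarith,
    by linarith, by linarith, hC4, by linarith, hC6⟩

end AnalyticCentre

namespace AnalyticCentre

/-! ### Scalar inequalities -/

/-! The value of `potential` at the centre starts nonnegative and rises by a fixed amount in every
iteration. The step `Invariant.step` carries this along with `z` in the open region, Newton
decrement below `ρ₀` and all `κ` positive.

The analysis is self-concordance by hand. Along a segment from `x` to `x + d` the barrier is a sum
of terms `-ln(1 + τt)`: a cut gives one relative slack change `t`, and the ball gives two, since `1
- ‖·‖²` factors on a line (`exists_line_factors`). The squares of the `t` add up to `r² = quad S x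
d`, so scalar inequalities yield `F(x + d) ≥ F(x) + ∇F(x)ᵀd + r - ln(1 + r)` (`barrier_add_ge`).
Estimates in a direction other than `d` are proved term by term (`grad_sub_inner_le`,
`quad_compare`). A decrement below `ρ₀` puts the centre within local distance `ζ₀` of `z`
(`IsCentre.quad_sub_le`), so what the algorithm tests at `z` holds approximately at the centre.

Write `w`, `w'` for the old and new centres. Discarding (`discard_growth`): the remaining barrier
has gradient `a/s` at `w`, where `s` is the slack of the dropped cut at `w`. Small `σ` makes the
linear term at least `-r/3`, while `s/κ ≥ 3/2`; the gain is at least `1/3`. Resetting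
(`reset_growth`): the centre stays and `κ` more than doubles, a gain of at least `ln 2`. Adding
(`add_growth`): the new cut pushes the centre by local distance at least `C₅` (`C5_le_dist`), which
raises the old barrier by at least `C₆`. The new slack at `w'` exceeds `κ` by a factor of at most `1
+ ζ₀`, which costs at most `ζ₀`. -/

theorem sq_mul_sub_log_le {t r : ℝ} (ht : -1 < t) (hr : 0 ≤ r) (htr : t ≤ r) :
    t ^ 2 * (r - Real.log (1 + r)) ≤ r ^ 2 * (t - Real.log (1 + t)) := by
  -- The claim is that `(t - ln(1 + t))/t²` decreases in `t`. Scaling both arguments by `τ` from 0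
  -- to 1 avoids dividing by `t`, which may vanish or be negative.
  set f : ℝ → ℝ := fun τ =>
    r ^ 2 * (τ * t - Real.log (1 + τ * t)) - t ^ 2 * (τ * r - Real.log (1 + τ * r)) with hf
  have ht' : ∀ τ ∈ Set.Icc (0 : ℝ) 1, 0 < 1 + τ * t := fun τ hτ => by
    obtain ⟨h0, h1⟩ := hτ
    rcases le_or_gt 0 t with h | h
    · positivity
    · nlinarith
  have hr' : ∀ τ ∈ Set.Icc (0 : ℝ) 1, 0 < 1 + τ * r := fun τ hτ => by
    have := hτ.1
    positivity
  have hd : ∀ τ ∈ Set.Icc (0 : ℝ) 1,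
      HasDerivAt f (r ^ 2 * (t - t / (1 + τ * t)) - t ^ 2 * (r - r / (1 + τ * r))) τ := by
    intro τ hτ
    have h1 : HasDerivAt (fun τ : ℝ => τ * t) t τ := by simpa using (hasDerivAt_id τ).mul_const t
    have h2 : HasDerivAt (fun τ : ℝ => τ * r) r τ := by simpa using (hasDerivAt_id τ).mul_const r
    have h3 := (h1.const_add 1).log (ht' τ hτ).ne'
    have h4 := (h2.const_add 1).log (hr' τ hτ).ne'
    exact ((h1.sub h3).const_mul (r ^ 2)).sub ((h2.sub h4).const_mul (t ^ 2))
  have hmono : MonotoneOn f (Set.Icc 0 1) := by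
    refine monotoneOn_of_deriv_nonneg (convex_Icc 0 1)
      (fun τ hτ => (hd τ hτ).continuousAt.continuousWithinAt)
      (fun τ hτ => (hd τ (interior_subset hτ)).differentiableAt.differentiableWithinAt) ?_
    intro τ hτ
    have hτ' := interior_subset hτ
    rw [(hd τ hτ').deriv]
    have h1 := ht' τ hτ'
    have h2 := hr' τ hτ'
    have h0 := hτ'.1
    have key : ∀ u : ℝ, 0 < 1 + τ * u → u - u / (1 + τ * u) = τ * u ^ 2 * (1 + τ * u)⁻¹ := by
      intro u hu
      rw [← div_eq_mul_inv, eq_div_iff hu.ne', sub_mul, div_mul_cancel₀ _ hu.ne']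
      ring
    rw [key t h1, key r h2]
    have h3 : (1 + τ * r)⁻¹ ≤ (1 + τ * t)⁻¹ := by gcongr
    have : 0 ≤ τ * t ^ 2 * r ^ 2 * ((1 + τ * t)⁻¹ - (1 + τ * r)⁻¹) :=
      mul_nonneg (by positivity) (by linarith)
    linarith
  have := hmono (Set.left_mem_Icc.2 zero_le_one) (Set.right_mem_Icc.2 zero_le_one) zero_le_one
  simp only [hf, zero_mul, one_mul, add_zero, Real.log_one, sub_zero, mul_zero] at this
  linarith

theorem sub_log_nonneg {t : ℝ} (ht : -1 < t) : 0 ≤ t - Real.log (1 + t) := by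
  have := Real.log_le_sub_one_of_pos (by linarith : 0 < 1 + t)
  linarith

theorem le_sqrt_sum_sq {T : Multiset ℝ} {t : ℝ} (ht : t ∈ T) :
    |t| ≤ √(T.map fun t => t ^ 2).sum := by
  rw [← Real.sqrt_sq_eq_abs]
  refine Real.sqrt_le_sqrt (Multiset.single_le_sum ?_ _ (Multiset.mem_map_of_mem _ ht))
  intro s hs
  obtain ⟨u, -, rfl⟩ := Multiset.mem_map.1 hs
  positivity

theorem sum_sq_nonneg (T : Multiset ℝ) : 0 ≤ (T.map fun t => t ^ 2).sum :=
  Multiset.sum_nonneg fun s hs => by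
    obtain ⟨u, -, rfl⟩ := Multiset.mem_map.1 hs
    positivity

/-- Each `t` is at most the Euclidean norm `r` of the family, so its term is at least the share
`t²/r²` of `r - ln(1 + r)`; the shares add up to 1. -/
theorem sqrt_sub_log_le_sum (T : Multiset ℝ) (hT : ∀ t ∈ T, -1 < t) :
    √(T.map fun t => t ^ 2).sum - Real.log (1 + √(T.map fun t => t ^ 2).sum)
      ≤ (T.map fun t => t - Real.log (1 + t)).sum := by
  set r := √(T.map fun t => t ^ 2).sum with hr
  have hr2 : r ^ 2 = (T.map fun t => t ^ 2).sum := Real.sq_sqrt (sum_sq_nonneg T)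
  have hr0 : 0 ≤ r := Real.sqrt_nonneg _
  rcases hr0.eq_or_lt with h | h
  · rw [← h]
    simp only [add_zero, Real.log_one, sub_zero]
    refine Multiset.sum_nonneg fun s hs => ?_
    obtain ⟨u, hu, rfl⟩ := Multiset.mem_map.1 hs
    exact sub_log_nonneg (hT u hu)
  · have h1 : (T.map fun t => t ^ 2 * (r - Real.log (1 + r))).sum
        ≤ (T.map fun t => r ^ 2 * (t - Real.log (1 + t))).sum :=
      Multiset.sum_map_le_sum_map _ _ fun t ht =>
        sq_mul_sub_log_le (hT t ht) hr0 ((le_abs_self t).trans (le_sqrt_sum_sq ht))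
    rw [Multiset.sum_map_mul_right, Multiset.sum_map_mul_left, ← hr2] at h1
    exact le_of_mul_le_mul_left h1 (by positivity)

theorem sum_sq_div_le (T : Multiset ℝ) (hT : ∀ t ∈ T, -1 < t) :
    (T.map fun t => t ^ 2).sum / (1 + √(T.map fun t => t ^ 2).sum)
      ≤ (T.map fun t => t - t / (1 + t)).sum := by
  rw [div_eq_mul_inv, ← Multiset.sum_map_mul_right]
  refine Multiset.sum_map_le_sum_map _ _ fun t ht => ?_
  have h1 := hT t ht
  have h2 := (le_abs_self t).trans (le_sqrt_sum_sq ht)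
  have h3 : t - t / (1 + t) = t ^ 2 * (1 + t)⁻¹ := by
    have : 1 + t ≠ 0 := by linarith
    field_simp
    ring
  rw [h3]
  have : 0 < 1 + t := by linarith
  gcongr

/-! ### The ball term -/

section Ball

variable {E : Type*} [NormedAddCommGroup E] [InnerProductSpace ℝ E]

theorem one_sub_norm_sq_pos {E : Type*} [NormedAddCommGroup E] {x : E} (hx : ‖x‖ < 1) : 0 < 1 - ‖x‖ ^ 2 := by
  nlinarith [norm_nonneg x]

/-- On a line, `1 - ‖·‖²` splits into two linear factors. -/
theorem exists_ball_factors {x : E} (hx : ‖x‖ < 1) (d : E) :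
    ∃ α β : ℝ, α ≤ 0 ∧ 0 ≤ β ∧ α + β = -(2 * inner ℝ x d / (1 - ‖x‖ ^ 2)) ∧
      α * β = -(‖d‖ ^ 2 / (1 - ‖x‖ ^ 2)) := by
  have hw := one_sub_norm_sq_pos hx
  set m := -(2 * inner ℝ x d / (1 - ‖x‖ ^ 2))
  set k := ‖d‖ ^ 2 / (1 - ‖x‖ ^ 2)
  have hk : 0 ≤ k := by positivity
  have hs : √(m ^ 2 + 4 * k) ^ 2 = m ^ 2 + 4 * k := Real.sq_sqrt (by positivity)
  have hm : |m| ≤ √(m ^ 2 + 4 * k) := Real.abs_le_sqrt (by linarith)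
  obtain ⟨h1, h2⟩ := abs_le.1 hm
  exact ⟨(m - √(m ^ 2 + 4 * k)) / 2, (m + √(m ^ 2 + 4 * k)) / 2, by linarith, by linarith,
    by ring, by linarith⟩

theorem ball_factor_sq {x d : E} {α β : ℝ}
    (h1 : α + β = -(2 * inner ℝ x d / (1 - ‖x‖ ^ 2)))
    (h2 : α * β = -(‖d‖ ^ 2 / (1 - ‖x‖ ^ 2))) :
    α ^ 2 + β ^ 2 = 4 / (1 - ‖x‖ ^ 2) ^ 2 * inner ℝ x d ^ 2 + 2 / (1 - ‖x‖ ^ 2) * ‖d‖ ^ 2 := by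
  have : α ^ 2 + β ^ 2 = (α + β) ^ 2 - 2 * (α * β) := by ring
  rw [this, h1, h2]
  generalize 1 - ‖x‖ ^ 2 = w
  ring

theorem ball_factor_mul {x d : E} (hx : ‖x‖ < 1) {α β : ℝ}
    (h1 : α + β = -(2 * inner ℝ x d / (1 - ‖x‖ ^ 2)))
    (h2 : α * β = -(‖d‖ ^ 2 / (1 - ‖x‖ ^ 2))) :
    1 - ‖x + d‖ ^ 2 = (1 - ‖x‖ ^ 2) * ((1 + α) * (1 + β)) := by
  have hw := (one_sub_norm_sq_pos hx).ne'
  have : (1 + α) * (1 + β) = 1 + (α + β) + α * β := by ring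
  rw [this, h1, h2, norm_add_sq_real]
  field_simp
  ring

/-- Positivity of the product alone would allow two negative factors; `0 ≤ β` rules this out. -/
theorem ball_factors_pos {x d : E} (hx : ‖x‖ < 1) (hy : ‖x + d‖ < 1) {α β : ℝ} (hβ : 0 ≤ β)
    (h1 : α + β = -(2 * inner ℝ x d / (1 - ‖x‖ ^ 2)))
    (h2 : α * β = -(‖d‖ ^ 2 / (1 - ‖x‖ ^ 2))) : 0 < 1 + α := by
  have h := one_sub_norm_sq_pos hy
  rw [ball_factor_mul hx h1 h2] at h
  have h3 := pos_of_mul_pos_right h (one_sub_norm_sq_pos hx).le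
  exact pos_of_mul_pos_left h3 (by linarith)

/-- The ball's share of `grad_sub_inner_le`. The direction `e` need not be parallel to `d`, so the
linear factors do not suffice; instead the difference of the two sides is an explicit sum of
nonnegative terms. -/
theorem ball_grad_sub_le {x d : E} (hx : ‖x‖ < 1) (hy : ‖x + d‖ < 1) {α β : ℝ} (hβ : 0 ≤ β)
    (h1 : α + β = -(2 * inner ℝ x d / (1 - ‖x‖ ^ 2)))
    (h2 : α * β = -(‖d‖ ^ 2 / (1 - ‖x‖ ^ 2))) (e : E) :
    2 * (2 / (1 - ‖x + d‖ ^ 2) * inner ℝ (x + d) e - 2 / (1 - ‖x‖ ^ 2) * inner ℝ x e)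
      ≤ 4 / (1 - ‖x‖ ^ 2) ^ 2 * inner ℝ x e ^ 2 + 2 / (1 - ‖x‖ ^ 2) * ‖e‖ ^ 2
        + ((α / (1 + α)) ^ 2 + (β / (1 + β)) ^ 2) := by
  have hα1 := ball_factors_pos hx hy hβ h1 h2
  have hw := one_sub_norm_sq_pos hx
  have hβ1 : 0 < 1 + β := by linarith
  rw [ball_factor_mul hx h1 h2, inner_add_left]
  set w := 1 - ‖x‖ ^ 2
  set ρ := (1 + α) * (1 + β) with hρ
  have hρ0 : 0 < ρ := by positivity
  have hd : ‖d‖ ^ 2 = -(α * β) * w := by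
    rw [h2]; field_simp
  have hsq : 0 ≤ ‖e - ρ⁻¹ • d‖ ^ 2 := by positivity
  rw [norm_sub_sq_real, norm_smul, inner_smul_right, mul_pow, hd, real_inner_comm,
    Real.norm_eq_abs, sq_abs] at hsq
  have hA : 0 ≤ (2 * inner ℝ x e / w - (1 - ρ) / ρ) ^ 2 := by positivity
  have hN : (α / (1 + α)) ^ 2 + (β / (1 + β)) ^ 2
      = ((1 - ρ) / ρ) ^ 2 - 2 * (α * β) / ρ ^ 2 + α ^ 2 * β ^ 2 / ρ ^ 2 := by
    rw [hρ]
    field_simp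
    ring
  have hB : 0 ≤ α ^ 2 * β ^ 2 / ρ ^ 2 := by positivity
  have hsq' : 0 ≤ 2 / w * (‖e‖ ^ 2 - 2 * (ρ⁻¹ * inner ℝ d e) + ρ⁻¹ ^ 2 * (-(α * β) * w)) := by
    positivity
  rw [hN]
  have key : 4 / w ^ 2 * inner ℝ x e ^ 2 + 2 / w * ‖e‖ ^ 2
        + (((1 - ρ) / ρ) ^ 2 - 2 * (α * β) / ρ ^ 2 + α ^ 2 * β ^ 2 / ρ ^ 2)
      - 2 * (2 / (w * ρ) * (inner ℝ x e + inner ℝ d e) - 2 / w * inner ℝ x e)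
      = (2 * inner ℝ x e / w - (1 - ρ) / ρ) ^ 2
        + 2 / w * (‖e‖ ^ 2 - 2 * (ρ⁻¹ * inner ℝ d e) + ρ⁻¹ ^ 2 * (-(α * β) * w))
        + α ^ 2 * β ^ 2 / ρ ^ 2 := by
    field_simp
    ring
  linarith

/-- The scalar core of the comparison of Hessians of the ball term. -/
theorem ball_form_le {α β A D s : ℝ} (hα : α ≤ 0) (hα1 : 0 < 1 + α) (hβ : 0 ≤ β) (hs : 0 ≤ s)
    (hD : D ^ 2 ≤ -(2 * (α * β)) * s) :
    (A + D) ^ 2 + (1 + α) * (1 + β) * s ≤ (1 + β) ^ 2 * (A ^ 2 + s) := by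
  rcases hβ.eq_or_lt with h | h
  · subst h
    have : D = 0 := by nlinarith [sq_nonneg D]
    subst this
    nlinarith
  -- `β(2 + β) = (1 + β)² - 1` is the surplus coefficient of `A²`. After multiplication by it the
  -- claim is the sum of `h1` (a completed square), `h2` and `h3`.
  · have hk : 0 < β * (2 + β) := by positivity
    have h1 : 0 ≤ (β * (2 + β) * A - D) ^ 2 := by positivity
    have h2 : 0 ≤ β * β * (1 + β) * (2 + β + α) * s := by
      have : 0 ≤ 2 + β + α := by linarith
      positivity
    have h3 : 0 ≤ (1 + β) ^ 2 * (-(2 * (α * β)) * s - D ^ 2) :=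
      mul_nonneg (by positivity) (by linarith)
    have : 0 ≤ (β * (2 + β)) *
        ((1 + β) ^ 2 * (A ^ 2 + s) - ((A + D) ^ 2 + (1 + α) * (1 + β) * s)) := by
      nlinarith
    have := nonneg_of_mul_nonneg_right this hk
    linarith

theorem le_ball_form {α β A D s : ℝ} (hα : α ≤ 0) (hα1 : 0 < 1 + α) (hβ : 0 ≤ β) (hs : 0 ≤ s)
    (hD : D ^ 2 ≤ -(2 * (α * β)) * s) :
    (1 + α) ^ 2 * (A ^ 2 + s) ≤ (A + D) ^ 2 + (1 + α) * (1 + β) * s := by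
  rcases hα.eq_or_lt with h | h
  · subst h
    have : D = 0 := by nlinarith [sq_nonneg D]
    subst this
    nlinarith
  · have hk : 0 < -α * (2 + α) := mul_pos (by linarith) (by linarith)
    have h1 : 0 ≤ (-α * (2 + α) * A + D) ^ 2 := by positivity
    have h2 : 0 ≤ α * α * (1 + α) * (2 + β + α) * s := by
      have : 0 ≤ 2 + β + α := by linarith
      have := mul_self_nonneg α
      positivity
    have h3 : 0 ≤ (1 + α) ^ 2 * (-(2 * (α * β)) * s - D ^ 2) :=
      mul_nonneg (by positivity) (by linarith)
    have : 0 ≤ (-α * (2 + α)) *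
        ((A + D) ^ 2 + (1 + α) * (1 + β) * s - (1 + α) ^ 2 * (A ^ 2 + s)) := by
      nlinarith
    have := nonneg_of_mul_nonneg_right this hk
    linarith

theorem ball_hess_compare {x d : E} (hx : ‖x‖ < 1) {ζ : ℝ} (hζ0 : 0 ≤ ζ) (hζ : ζ < 1)
    (hd : 4 / (1 - ‖x‖ ^ 2) ^ 2 * inner ℝ x d ^ 2 + 2 / (1 - ‖x‖ ^ 2) * ‖d‖ ^ 2 ≤ ζ ^ 2) (e : E) :
    (1 - ζ) ^ 2 * (4 / (1 - ‖x‖ ^ 2) ^ 2 * inner ℝ x e ^ 2 + 2 / (1 - ‖x‖ ^ 2) * ‖e‖ ^ 2)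
      ≤ 4 / (1 - ‖x + d‖ ^ 2) ^ 2 * inner ℝ (x + d) e ^ 2 + 2 / (1 - ‖x + d‖ ^ 2) * ‖e‖ ^ 2 ∧
    (1 - ζ) ^ 2 * (4 / (1 - ‖x + d‖ ^ 2) ^ 2 * inner ℝ (x + d) e ^ 2
        + 2 / (1 - ‖x + d‖ ^ 2) * ‖e‖ ^ 2)
      ≤ 4 / (1 - ‖x‖ ^ 2) ^ 2 * inner ℝ x e ^ 2 + 2 / (1 - ‖x‖ ^ 2) * ‖e‖ ^ 2 := by
  obtain ⟨α, β, hα, hβ, h1, h2⟩ := exists_ball_factors hx d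
  rw [← ball_factor_sq h1 h2] at hd
  have hαζ : -ζ ≤ α := (abs_le.1 (abs_le_of_sq_le_sq (by nlinarith) hζ0)).1
  have hβζ : β ≤ ζ := (abs_le.1 (abs_le_of_sq_le_sq (by nlinarith) hζ0)).2
  have hα1 : 0 < 1 + α := by linarith
  have hβ1 : 0 < 1 + β := by linarith
  have hw := one_sub_norm_sq_pos hx
  rw [ball_factor_mul hx h1 h2, inner_add_left]
  set w := 1 - ‖x‖ ^ 2
  have hdn : ‖d‖ ^ 2 = -(α * β) * w := by rw [h2]; field_simp
  have hD : (2 * inner ℝ d e / w) ^ 2 ≤ -(2 * (α * β)) * (2 / w * ‖e‖ ^ 2) := by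
    have h3 : inner ℝ d e ^ 2 ≤ ‖d‖ ^ 2 * ‖e‖ ^ 2 := by
      rw [← mul_pow, ← sq_abs]
      exact pow_le_pow_left₀ (abs_nonneg _) (abs_real_inner_le_norm d e) 2
    rw [hdn] at h3
    calc (2 * inner ℝ d e / w) ^ 2 = 4 / w ^ 2 * inner ℝ d e ^ 2 := by ring_nf
      _ ≤ 4 / w ^ 2 * (-(α * β) * w * ‖e‖ ^ 2) := by gcongr
      _ = _ := by field_simp; ring
  have hs : 0 ≤ 2 / w * ‖e‖ ^ 2 := by positivity
  have hu := ball_form_le (A := 2 * inner ℝ x e / w) hα hα1 hβ hs hD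
  have hl := le_ball_form (A := 2 * inner ℝ x e / w) hα hα1 hβ hs hD
  have hQ : 0 ≤ (2 * inner ℝ x e / w) ^ 2 + 2 / w * ‖e‖ ^ 2 := by positivity
  have e1 : 4 / w ^ 2 * inner ℝ x e ^ 2 + 2 / w * ‖e‖ ^ 2
      = (2 * inner ℝ x e / w) ^ 2 + 2 / w * ‖e‖ ^ 2 := by ring_nf
  have e2 : 4 / (w * ((1 + α) * (1 + β))) ^ 2 * (inner ℝ x e + inner ℝ d e) ^ 2
        + 2 / (w * ((1 + α) * (1 + β))) * ‖e‖ ^ 2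
      = ((2 * inner ℝ x e / w + 2 * inner ℝ d e / w) ^ 2
          + (1 + α) * (1 + β) * (2 / w * ‖e‖ ^ 2)) / ((1 + α) * (1 + β)) ^ 2 := by
    field_simp
    ring
  rw [e1, e2]
  set Q := (2 * inner ℝ x e / w) ^ 2 + 2 / w * ‖e‖ ^ 2
  set Q' := (2 * inner ℝ x e / w + 2 * inner ℝ d e / w) ^ 2
          + (1 + α) * (1 + β) * (2 / w * ‖e‖ ^ 2)
  constructor
  · rw [le_div_iff₀ (by positivity)]
    refine le_trans ?_ hl
    have : ((1 - ζ) * (1 + β)) ^ 2 ≤ 1 := by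
      refine pow_le_one₀ (mul_nonneg (by linarith) hβ1.le) ?_
      nlinarith
    calc (1 - ζ) ^ 2 * Q * ((1 + α) * (1 + β)) ^ 2
        = ((1 - ζ) * (1 + β)) ^ 2 * ((1 + α) ^ 2 * Q) := by ring
      _ ≤ 1 * ((1 + α) ^ 2 * Q) := by gcongr
      _ = _ := one_mul _
  · rw [← mul_div_assoc, div_le_iff₀ (by positivity)]
    calc (1 - ζ) ^ 2 * Q' ≤ (1 + α) ^ 2 * ((1 + β) ^ 2 * Q) := by
          have : 0 ≤ 1 - ζ := by linarith
          gcongr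
          linarith
      _ = _ := by ring

end Ball

/-! ### The Hessian form -/

/-- The quadratic form `dᵀ∇²F(x)d`. -/
noncomputable def quad {n : ℕ} (S : Multiset (Cut n)) (x d : Vec n) : ℝ := inner ℝ d (hess S x d)

theorem inner_sum_rankOne {n : ℕ} (S : Multiset (Cut n)) (x d v : Vec n) :
    inner ℝ v ((S.map fun e => (1 / e.slack x ^ 2) • InnerProductSpace.rankOne ℝ e.a e.a).sum d)
      = (S.map fun e => inner ℝ e.a v / e.slack x * (inner ℝ e.a d / e.slack x)).sum := by
  induction S using Multiset.induction_on with
  | empty => simp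
  | cons e T ih =>
    simp only [Multiset.map_cons, Multiset.sum_cons, add_apply, inner_add_right, ih]
    simp [inner_smul_right, real_inner_comm v]
    ring

theorem quad_eq {n : ℕ} (S : Multiset (Cut n)) (x d : Vec n) :
    quad S x d = (S.map fun e => (inner ℝ e.a d / e.slack x) ^ 2).sum
      + (4 / (1 - ‖x‖ ^ 2) ^ 2 * inner ℝ x d ^ 2 + 2 / (1 - ‖x‖ ^ 2) * ‖d‖ ^ 2) := by
  simp only [quad, hess, add_apply, inner_add_right, inner_sum_rankOne, pow_two (inner ℝ _ d / _)]
  simp [inner_smul_right, real_inner_comm d]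
  ring

theorem hess_symm {n : ℕ} (S : Multiset (Cut n)) (x u v : Vec n) :
    inner ℝ u (hess S x v) = inner ℝ (hess S x u) v := by
  rw [real_inner_comm v]
  simp only [hess, add_apply, inner_add_right, inner_sum_rankOne]
  simp only [mul_comm (inner ℝ _ u / _)]
  simp [inner_smul_right, real_inner_comm u v, real_inner_comm v x, real_inner_comm u x,
    mul_comm (inner ℝ u x)]

theorem inner_grad {n : ℕ} (S : Multiset (Cut n)) (x d : Vec n) :
    inner ℝ (grad S x) d = -(S.map fun e => inner ℝ e.a d / e.slack x).sum
      + 2 / (1 - ‖x‖ ^ 2) * inner ℝ x d := by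
  have : ∀ T : Multiset (Cut n), inner ℝ (T.map fun e => (e.slack x)⁻¹ • e.a).sum d
      = (T.map fun e => inner ℝ e.a d / e.slack x).sum := by
    intro T
    induction T using Multiset.induction_on with
    | empty => simp
    | cons e T ih => simp [inner_add_left, ih, inner_smul_left]; ring
  rw [grad, inner_add_left, inner_neg_left, this, inner_smul_left]
  simp

theorem quad_cons {n : ℕ} (S : Multiset (Cut n)) (e : Cut n) (x d : Vec n) :
    quad (e ::ₘ S) x d = (inner ℝ e.a d / e.slack x) ^ 2 + quad S x d := by
  simp [quad_eq]
  ring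

theorem inner_grad_cons {n : ℕ} (S : Multiset (Cut n)) (e : Cut n) (x d : Vec n) :
    inner ℝ (grad (e ::ₘ S) x) d = -(inner ℝ e.a d / e.slack x) + inner ℝ (grad S x) d := by
  simp [inner_grad]
  ring

theorem barrier_cons {n : ℕ} (S : Multiset (Cut n)) (e : Cut n) (x : Vec n) :
    barrier (e ::ₘ S) x = barrier S x - Real.log (e.slack x) := by
  simp [barrier]
  ring

theorem mem_region_cons {n : ℕ} {S : Multiset (Cut n)} {e : Cut n} {x : Vec n} :
    x ∈ region (e ::ₘ S) ↔ 0 < e.slack x ∧ x ∈ region S := by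
  simp [region]
  tauto

theorem slack_add {n : ℕ} (e : Cut n) {x : Vec n} (hx : 0 < e.slack x) (d : Vec n) :
    e.slack (x + d) = e.slack x * (1 + inner ℝ e.a d / e.slack x) := by
  have := hx.ne'
  rw [mul_add, mul_div_cancel₀ _ this]
  simp [Cut.slack, inner_add_right]
  ring

section Forms

variable {n : ℕ} {S : Multiset (Cut n)} {x : Vec n}

/-- The ball term alone makes the Hessian positive definite, whatever the cuts; invertibility and
uniqueness of the centre rest on this. -/
theorem norm_sq_le_quad (hx : x ∈ region S) (d : Vec n) :
    2 / (1 - ‖x‖ ^ 2) * ‖d‖ ^ 2 ≤ quad S x d := by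
  have hw := one_sub_norm_sq_pos hx.1
  rw [quad_eq]
  have h1 : 0 ≤ (S.map fun e => (inner ℝ e.a d / e.slack x) ^ 2).sum :=
    Multiset.sum_nonneg fun s hs => by
      obtain ⟨u, -, rfl⟩ := Multiset.mem_map.1 hs
      positivity
  have h2 : 0 ≤ 4 / (1 - ‖x‖ ^ 2) ^ 2 * inner ℝ x d ^ 2 := by positivity
  linarith

theorem quad_nonneg (hx : x ∈ region S) (d : Vec n) : 0 ≤ quad S x d := by
  have hw := one_sub_norm_sq_pos hx.1
  exact le_trans (by positivity) (norm_sq_le_quad hx d)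

theorem eq_zero_of_quad_le_zero (hx : x ∈ region S) {d : Vec n} (h : quad S x d ≤ 0) : d = 0 := by
  have hw := one_sub_norm_sq_pos hx.1
  have h1 := (norm_sq_le_quad hx d).trans h
  have h2 : ‖d‖ ^ 2 ≤ 0 := by
    by_contra! h3
    have : 0 < 2 / (1 - ‖x‖ ^ 2) * ‖d‖ ^ 2 := by positivity
    linarith
  simpa using le_antisymm h2 (by positivity)

theorem hess_hessInv (hx : x ∈ region S) (v : Vec n) : hess S x (hessInv S x v) = v := by
  have hinj : Function.Injective (hess S x) := by
    rw [injective_iff_map_eq_zero]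
    intro d hd
    exact eq_zero_of_quad_le_zero hx (by simp [quad, hd])
  let L : Vec n ≃L[ℝ] Vec n :=
    (LinearEquiv.ofInjectiveEndo (hess S x : Vec n →ₗ[ℝ] Vec n) hinj).toContinuousLinearEquiv
  have hL : hess S x = (L : Vec n →L[ℝ] Vec n) := by
    ext v
    rfl
  rw [hessInv, hL, ContinuousLinearMap.inverse_equiv]
  simp

/-- The dual form `aᵀ(∇²F(x))⁻¹a`. -/
noncomputable def dual {n : ℕ} (S : Multiset (Cut n)) (x a : Vec n) : ℝ := inner ℝ a (hessInv S x a)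

theorem quad_hessInv (hx : x ∈ region S) (a : Vec n) : quad S x (hessInv S x a) = dual S x a := by
  rw [quad, hess_hessInv hx, dual, real_inner_comm]

theorem dual_nonneg (hx : x ∈ region S) (a : Vec n) : 0 ≤ dual S x a := by
  rw [← quad_hessInv hx]
  exact quad_nonneg hx _

theorem quad_smul (S : Multiset (Cut n)) (x : Vec n) (k : ℝ) (d : Vec n) :
    quad S x (k • d) = k ^ 2 * quad S x d := by
  simp [quad, inner_smul_left, inner_smul_right]
  ring

theorem quad_neg (S : Multiset (Cut n)) (x d : Vec n) : quad S x (-d) = quad S x d := by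
  simp [quad]

theorem quad_add (S : Multiset (Cut n)) (x u v : Vec n) :
    quad S x (u + v) = quad S x u + 2 * inner ℝ u (hess S x v) + quad S x v := by
  simp only [quad, map_add, inner_add_left, inner_add_right]
  rw [hess_symm S x v u, real_inner_comm u (hess S x v)]
  ring

theorem inner_hess_sq_le (hx : x ∈ region S) (u v : Vec n) :
    inner ℝ u (hess S x v) ^ 2 ≤ quad S x u * quad S x v := by
  have h : ∀ k : ℝ, 0 ≤ quad S x v * (k * k) + 2 * inner ℝ u (hess S x v) * k + quad S x u := by
    intro k
    have := quad_nonneg hx (u + k • v)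
    rw [quad_add, quad_smul, map_smul, inner_smul_right] at this
    linarith
  have := discrim_le_zero h
  rw [discrim] at this
  linarith

theorem inner_sq_le_dual_mul_quad (hx : x ∈ region S) (a d : Vec n) :
    inner ℝ a d ^ 2 ≤ dual S x a * quad S x d := by
  have := inner_hess_sq_le hx d (hessInv S x a)
  rwa [hess_hessInv hx, quad_hessInv hx, mul_comm, real_inner_comm] at this

theorem abs_inner_le (hx : x ∈ region S) (a d : Vec n) :
    |inner ℝ a d| ≤ √(dual S x a) * √(quad S x d) := by
  rw [← Real.sqrt_mul (dual_nonneg hx a)]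
  exact Real.abs_le_sqrt (inner_sq_le_dual_mul_quad hx a d)

theorem sqrt_quad_add_le (hx : x ∈ region S) (u v : Vec n) :
    √(quad S x (u + v)) ≤ √(quad S x u) + √(quad S x v) := by
  rw [Real.sqrt_le_left (by positivity), quad_add, add_sq, Real.sq_sqrt (quad_nonneg hx u),
    Real.sq_sqrt (quad_nonneg hx v)]
  have : |inner ℝ u (hess S x v)| ≤ √(quad S x u) * √(quad S x v) := by
    rw [← Real.sqrt_mul (quad_nonneg hx u)]
    exact Real.abs_le_sqrt (inner_hess_sq_le hx u v)
  linarith [le_abs_self (inner ℝ u (hess S x v))]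

/-- Comparison of quadratic forms reverses under duality. -/
theorem dual_le_of_quad_le {y : Vec n} (hx : x ∈ region S) (hy : y ∈ region S) {k : ℝ} (hk : 0 ≤ k)
    (h : ∀ e, quad S x e ≤ k * quad S y e) (a : Vec n) : dual S y a ≤ k * dual S x a := by
  -- Cauchy–Schwarz in the local norm at `x`, tested on the vector that realises the dual norm of
  -- `a` at `y`.
  have h1 := inner_sq_le_dual_mul_quad hx a (hessInv S y a)
  have h2 := h (hessInv S y a)
  rw [quad_hessInv hy] at h2
  have h3 : dual S y a * dual S y a ≤ k * dual S x a * dual S y a := by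
    calc dual S y a * dual S y a = inner ℝ a (hessInv S y a) ^ 2 := by rw [dual]; ring
      _ ≤ dual S x a * (k * dual S y a) := h1.trans (by gcongr; exact dual_nonneg hx a)
      _ = _ := by ring
  rcases (dual_nonneg hy a).eq_or_lt with h0 | h0
  · rw [← h0]
    exact mul_nonneg hk (dual_nonneg hx a)
  · exact le_of_mul_le_mul_right h3 h0

/-! ### The barrier along lines -/

/-- Along the line `x + τd` the barrier is a sum of terms `-ln(1 + τt)`. -/
theorem exists_line_factors (hx : x ∈ region S) (d : Vec n) :
    ∃ T : Multiset ℝ, (T.map fun t => t ^ 2).sum = quad S x d ∧ T.sum = -inner ℝ (grad S x) d ∧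
      ((∀ t ∈ T, -1 < t) → x + d ∈ region S) ∧
      (x + d ∈ region S → (∀ t ∈ T, -1 < t) ∧
        (T.map fun t => Real.log (1 + t)).sum = barrier S x - barrier S (x + d) ∧
        (T.map fun t => t / (1 + t)).sum = -inner ℝ (grad S (x + d)) d) := by
  have hw := one_sub_norm_sq_pos hx.1
  induction S using Multiset.induction_on with
  | empty =>
    obtain ⟨α, β, hα, hβ, h1, h2⟩ := exists_ball_factors hx.1 d
    have hm := ball_factor_mul hx.1 h1 h2
    refine ⟨{α, β}, ?_, ?_, ?_, ?_⟩
    · simpa [quad_eq] using ball_factor_sq h1 h2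
    · simp [inner_grad, h1]
      ring
    · intro h
      refine ⟨?_, by simp⟩
      have hα1 : 0 < 1 + α := by linarith [h α (by simp)]
      have : 0 < 1 - ‖x + d‖ ^ 2 := by
        rw [hm]
        have : 0 < 1 + β := by linarith
        positivity
      nlinarith [norm_nonneg (x + d)]
    · intro hy
      have hα1 := ball_factors_pos hx.1 hy.1 hβ h1 h2
      have hβ1 : 0 < 1 + β := by linarith
      refine ⟨by simp; constructor <;> linarith, ?_, ?_⟩
      · simp [barrier, hm]
        rw [Real.log_mul hw.ne' (by positivity), Real.log_mul hα1.ne' hβ1.ne']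
        ring
      · simp [inner_grad, hm, inner_add_left]
        have e1 : inner ℝ x d = -(α + β) * (1 - ‖x‖ ^ 2) / 2 := by
          rw [h1]; field_simp
        have e2 : ‖d‖ ^ 2 = -(α * β) * (1 - ‖x‖ ^ 2) := by
          rw [h2]; field_simp
        rw [e1, e2]
        field_simp
        ring
  | cons e S ih =>
    obtain ⟨he, hxS⟩ := mem_region_cons.1 hx
    obtain ⟨T, h1, h2, h3, h4⟩ := ih hxS
    have hs := slack_add e he d
    refine ⟨(inner ℝ e.a d / e.slack x) ::ₘ T, ?_, ?_, ?_, ?_⟩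
    · simp [quad_cons, h1]
    · simp [inner_grad_cons, h2]
      ring
    · intro h
      have h5 := h _ (Multiset.mem_cons_self _ _)
      refine mem_region_cons.2 ⟨?_, h3 fun t ht => h t (Multiset.mem_cons_of_mem ht)⟩
      rw [hs]
      exact mul_pos he (by linarith)
    · intro hy
      obtain ⟨hye, hyS⟩ := mem_region_cons.1 hy
      obtain ⟨h5, h6, h7⟩ := h4 hyS
      have ht : 0 < 1 + inner ℝ e.a d / e.slack x := by
        rw [hs] at hye
        exact pos_of_mul_pos_right hye he.le
      refine ⟨?_, ?_, ?_⟩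
      · intro t ht'
        rcases Multiset.mem_cons.1 ht' with rfl | ht'
        · linarith
        · exact h5 t ht'
      · simp only [Multiset.map_cons, Multiset.sum_cons, h6, barrier_cons, hs]
        rw [Real.log_mul he.ne' ht.ne']
        ring
      · simp only [Multiset.map_cons, Multiset.sum_cons, h7, inner_grad_cons, hs, div_div]
        ring

/-- The Dikin ellipsoid is contained in the domain of the barrier. -/
theorem add_mem_region (hx : x ∈ region S) {d : Vec n} (hd : quad S x d < 1) :
    x + d ∈ region S := by
  obtain ⟨T, h1, -, h3, -⟩ := exists_line_factors hx d
  refine h3 fun t ht => ?_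
  have h := le_sqrt_sum_sq ht
  rw [h1] at h
  have : √(quad S x d) < 1 := by
    rw [Real.sqrt_lt' one_pos]
    simpa using hd
  linarith [neg_abs_le t]

theorem barrier_add_ge (hx : x ∈ region S) {d : Vec n} (hy : x + d ∈ region S) :
    barrier S x + inner ℝ (grad S x) d + (√(quad S x d) - Real.log (1 + √(quad S x d)))
      ≤ barrier S (x + d) := by
  obtain ⟨T, h1, h2, -, h4⟩ := exists_line_factors hx d
  obtain ⟨h5, h6, -⟩ := h4 hy
  have := sqrt_sub_log_le_sum T h5
  rw [Multiset.sum_map_sub, Multiset.map_id', h1, h2, h6] at this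
  linarith

theorem grad_sub_inner_ge (hx : x ∈ region S) {d : Vec n} (hy : x + d ∈ region S) :
    quad S x d / (1 + √(quad S x d)) ≤ inner ℝ (grad S (x + d)) d - inner ℝ (grad S x) d := by
  obtain ⟨T, h1, h2, -, h4⟩ := exists_line_factors hx d
  obtain ⟨h5, -, h7⟩ := h4 hy
  have := sum_sq_div_le T h5
  rw [Multiset.sum_map_sub, Multiset.map_id', h1, h2, h7] at this
  linarith

theorem div_one_add_sq_le {t r : ℝ} (h : |t| ≤ r) (hr : r < 1) :
    (t / (1 + t)) ^ 2 ≤ t ^ 2 / (1 - r) ^ 2 := by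
  have h1 : 1 - r ≤ 1 + t := by linarith [neg_abs_le t]
  have h2 : 0 < 1 - r := by linarith
  rw [div_pow]
  gcongr

theorem abs_slack_ratio_le (hx : x ∈ region S) {e : Cut n} (he : e ∈ S) (d : Vec n) :
    |inner ℝ e.a d / e.slack x| ≤ √(quad S x d) := by
  obtain ⟨T, rfl⟩ := Multiset.exists_cons_of_mem he
  refine Real.abs_le_sqrt ?_
  rw [quad_cons]
  linarith [quad_nonneg (mem_region_cons.1 hx).2 d]

/-- A bound by a sum rather than by a product of norms is additive over the barrier terms, so it
follows by induction on the cuts. A suitable choice of `e` recovers the bound `r/(1 - r)` on the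
dual norm of the gradient change. -/
theorem grad_sub_inner_le (hx : x ∈ region S) {d : Vec n} {r : ℝ} (hr0 : 0 ≤ r) (hr : r < 1)
    (hd : quad S x d ≤ r ^ 2) (e : Vec n) :
    2 * (inner ℝ (grad S (x + d)) e - inner ℝ (grad S x) e)
      ≤ quad S x e + quad S x d / (1 - r) ^ 2 := by
  induction S using Multiset.induction_on with
  | empty =>
    have hy := add_mem_region hx (hd.trans_lt (by nlinarith))
    obtain ⟨α, β, hα, hβ, h1, h2⟩ := exists_ball_factors hx.1 d
    have hsq := ball_factor_sq h1 h2
    have hq : quad 0 x d = α ^ 2 + β ^ 2 := by rw [hsq]; simp [quad_eq]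
    rw [hq] at hd ⊢
    have hb := ball_grad_sub_le hx.1 hy.1 hβ h1 h2 e
    have hα' := div_one_add_sq_le (abs_le_of_sq_le_sq (by nlinarith) hr0 : |α| ≤ r) hr
    have hβ' := div_one_add_sq_le (abs_le_of_sq_le_sq (by nlinarith) hr0 : |β| ≤ r) hr
    rw [add_div]
    simp only [inner_grad, quad_eq, Multiset.map_zero, Multiset.sum_zero, neg_zero, zero_add]
    linarith
  | cons f S ih =>
    obtain ⟨hf, hxS⟩ := mem_region_cons.1 hx
    have ht : |inner ℝ f.a d / f.slack x| ≤ r :=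
      (abs_slack_ratio_le hx (Multiset.mem_cons_self f S) d).trans
        ((Real.sqrt_le_left hr0).2 hd)
    rw [quad_cons] at hd
    have h1 := ih hxS (by nlinarith)
    have h2 := div_one_add_sq_le ht hr
    rw [inner_grad_cons, inner_grad_cons, quad_cons, quad_cons, slack_add f hf, add_div]
    have h3 : 1 + inner ℝ f.a d / f.slack x ≠ 0 := by
      have := neg_abs_le (inner ℝ f.a d / f.slack x)
      linarith
    set t := inner ℝ f.a d / f.slack x
    have h4 : inner ℝ f.a e / (f.slack x * (1 + t))
        = inner ℝ f.a e / f.slack x - inner ℝ f.a e / f.slack x * (t / (1 + t)) := by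
      have := hf.ne'
      field_simp
      ring
    rw [h4]
    nlinarith [sq_nonneg (inner ℝ f.a e / f.slack x - t / (1 + t))]

/-- Every relative change `t` satisfies `1 - ζ ≤ 1 + t ≤ 1 + ζ ≤ 1/(1 - ζ)`, so each term of the
Hessian form changes by at most the factor `(1 - ζ)²`, in either direction. -/
theorem quad_compare (hx : x ∈ region S) {d : Vec n} {ζ : ℝ} (hζ0 : 0 ≤ ζ) (hζ : ζ < 1)
    (hd : quad S x d ≤ ζ ^ 2) (e : Vec n) :
    (1 - ζ) ^ 2 * quad S x e ≤ quad S (x + d) e ∧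
      (1 - ζ) ^ 2 * quad S (x + d) e ≤ quad S x e := by
  induction S using Multiset.induction_on with
  | empty =>
    simp only [quad_eq, Multiset.map_zero, Multiset.sum_zero, zero_add] at hd ⊢
    exact ball_hess_compare hx.1 hζ0 hζ hd e
  | cons f S ih =>
    obtain ⟨hf, hxS⟩ := mem_region_cons.1 hx
    have ht : |inner ℝ f.a d / f.slack x| ≤ ζ :=
      (abs_slack_ratio_le hx (Multiset.mem_cons_self f S) d).trans
        ((Real.sqrt_le_left hζ0).2 hd)
    rw [quad_cons] at hd
    obtain ⟨h1, h2⟩ := ih hxS (by nlinarith)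
    obtain ⟨ht1, ht2⟩ := abs_le.1 ht
    rw [quad_cons, quad_cons, slack_add f hf, ← div_div]
    set t := inner ℝ f.a d / f.slack x
    set u := inner ℝ f.a e / f.slack x
    have h3 : 0 < 1 + t := by linarith
    have h4 : 0 ≤ 1 - ζ := by linarith
    rw [div_pow u]
    constructor
    · have : (1 - ζ) ^ 2 * u ^ 2 ≤ u ^ 2 / (1 + t) ^ 2 := by
        rw [le_div_iff₀ (by positivity)]
        have : ((1 - ζ) * (1 + t)) ^ 2 ≤ 1 := pow_le_one₀ (by positivity) (by nlinarith)
        nlinarith [sq_nonneg u]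
      linarith
    · have : (1 - ζ) ^ 2 * (u ^ 2 / (1 + t) ^ 2) ≤ u ^ 2 := by
        rw [← mul_div_assoc, div_le_iff₀ (by positivity), mul_comm]
        gcongr
        linarith
      linarith

end Forms

/-! ### Analytic centres -/

section Centre

variable {n : ℕ} {S : Multiset (Cut n)} {x w : Vec n}

theorem continuous_slack (e : Cut n) : Continuous e.slack := by
  unfold Cut.slack
  fun_prop

theorem isOpen_region (S : Multiset (Cut n)) : IsOpen (region S) := by
  induction S using Multiset.induction_on with
  | empty =>
    have : region (0 : Multiset (Cut n)) = {x | ‖x‖ < 1} := by simp [region]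
    rw [this]
    exact isOpen_lt continuous_norm continuous_const
  | cons e S ih =>
    have : region (e ::ₘ S) = {x | 0 < e.slack x} ∩ region S := by
      ext x
      exact mem_region_cons
    rw [this]
    exact (isOpen_lt continuous_const (continuous_slack e)).inter ih

theorem IsCentre.grad_eq_zero (hw : IsCentre S w) : grad S w = 0 := by
  have h : IsLocalMin (barrier S) w := by
    filter_upwards [(isOpen_region S).mem_nhds hw.1] with x hx using hw.2 x hx
  have := h.hasFDerivAt_eq_zero (hasGradientAt_barrier S w hw.1).hasFDerivAt
  simpa using this

theorem IsCentre.barrier_ge (hw : IsCentre S w) (hx : x ∈ region S) :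
    barrier S w + (√(quad S w (x - w)) - Real.log (1 + √(quad S w (x - w)))) ≤ barrier S x := by
  have := barrier_add_ge hw.1 (d := x - w) (by simpa using hx)
  simpa [hw.grad_eq_zero] using this

theorem sub_log_pos {r : ℝ} (hr : 0 < r) : 0 < r - Real.log (1 + r) := by
  have := Real.log_lt_sub_one_of_pos (by linarith : 0 < 1 + r) (by linarith)
  linarith

theorem IsCentre.unique {v : Vec n} (hw : IsCentre S w) (hv : IsCentre S v) : v = w := by
  have h1 := hw.barrier_ge hv.1
  have h2 := hv.2 w hw.1
  rcases (Real.sqrt_nonneg (quad S w (v - w))).eq_or_lt with h | h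
  · exact sub_eq_zero.1 (eq_zero_of_quad_le_zero hw.1 (Real.sqrt_eq_zero'.1 h.symm))
  · linarith [sub_log_pos h]

theorem exists_isCentre (hx : x ∈ region S) : ∃ w, IsCentre S w := by
  -- On the region `F = -ln p`. Unlike `F`, `p` is continuous on the compact closed region and
  -- vanishes where a constraint is tight, so a maximiser is interior.
  set p : Vec n → ℝ := fun y => (S.map fun e => e.slack y).prod * (1 - ‖y‖ ^ 2) with hp
  have hpc : Continuous p := by
    refine Continuous.mul ?_ (by fun_prop)
    exact continuous_multiset_prod S fun e _ => continuous_slack e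
  set C : Set (Vec n) := Metric.closedBall 0 1 ∩ ⋂ e ∈ S, {y | 0 ≤ e.slack y} with hC
  have hCc : IsCompact C := by
    refine (isCompact_closedBall 0 1).inter_right ?_
    exact isClosed_biInter fun e _ => isClosed_le continuous_const (continuous_slack e)
  have hsub : region S ⊆ C := fun y hy =>
    ⟨by simpa using hy.1.le, Set.mem_iInter₂.2 fun e he => (hy.2 e he).le⟩
  have hpos : ∀ y ∈ region S, 0 < p y := fun y hy =>
    mul_pos (Multiset.prod_pos fun s hs => by
      obtain ⟨e, he, rfl⟩ := Multiset.mem_map.1 hs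
      exact hy.2 e he) (one_sub_norm_sq_pos hy.1)
  have hlog : ∀ y ∈ region S, barrier S y = -Real.log (p y) := by
    intro y hy
    -- The induction runs over subfamilies of the fixed `S`, so that the positivity of all slacks at
    -- `y` stays available.
    have h1 : ∀ T : Multiset (Cut n), T ≤ S →
        0 < (T.map fun e => e.slack y).prod ∧
        (T.map fun e => Real.log (e.slack y)).sum
          = Real.log (T.map fun e => e.slack y).prod := by
      intro T
      induction T using Multiset.induction_on with
      | empty => simp
      | cons e T ih =>
        intro hT
        obtain ⟨i1, i2⟩ := ih ((Multiset.le_cons_self T e).trans hT)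
        have he := hy.2 e (Multiset.mem_of_le hT (Multiset.mem_cons_self e T))
        simp only [Multiset.map_cons, Multiset.prod_cons, Multiset.sum_cons]
        exact ⟨mul_pos he i1, by rw [i2, Real.log_mul he.ne' i1.ne']⟩
    obtain ⟨h2, h3⟩ := h1 S le_rfl
    rw [barrier, h3, hp, Real.log_mul h2.ne' (one_sub_norm_sq_pos hy.1).ne']
    ring
  obtain ⟨w, hwC, hw⟩ := hCc.exists_isMaxOn ⟨x, hsub hx⟩ hpc.continuousOn
  have hw0 : 0 < p w := (hpos x hx).trans_le (hw (hsub hx))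
  have hwr : w ∈ region S := by
    refine ⟨?_, fun e he => ?_⟩
    · have h1 : ‖w‖ ≤ 1 := by simpa using hwC.1
      refine lt_of_le_of_ne h1 fun h2 => ?_
      simp [hp, h2] at hw0
    · have h1 : 0 ≤ e.slack w := Set.mem_iInter₂.1 hwC.2 e he
      refine lt_of_le_of_ne h1 fun h2 => hw0.ne' ?_
      have : (S.map fun e => e.slack w).prod = 0 :=
        Multiset.prod_eq_zero (Multiset.mem_map.2 ⟨e, he, h2.symm⟩)
      simp [hp, this]
  refine ⟨w, hwr, fun y hy => ?_⟩
  rw [hlog w hwr, hlog y hy]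
  exact neg_le_neg (Real.log_le_log (hpos y hy) (hw (hsub hy)))

/-! ### Newton decrement and Newton steps. -/

theorem le_q {t v : ℝ} (hv : v ≤ 1) (ht : t ≤ 1 / 3) (h : 1 - 3 * t ≤ (1 - v) ^ 3) : v ≤ q t := by
  have h1 : 0 ≤ 1 - v := by linarith
  have h2 : (1 - 3 * t) ^ (1 / 3 : ℝ) ≤ ((1 - v) ^ 3) ^ (1 / 3 : ℝ) :=
    Real.rpow_le_rpow (by linarith) h (by norm_num)
  have h3 : ((1 - v) ^ 3) ^ (1 / 3 : ℝ) = 1 - v := by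
    rw [← Real.rpow_natCast, ← Real.rpow_mul h1]
    norm_num
  rw [h3] at h2
  unfold q
  linarith

/-- Monotonicity of the gradient gives the radius `t/(1 - t)`; this converts it to the `q` of the
algorithm. After cubing, the margin is `t³(2 - 3t)`. -/
theorem div_one_sub_le_q {t : ℝ} (h0 : 0 ≤ t) (h1 : t < 1 / 3) : t / (1 - t) ≤ q t := by
  have h2 : 0 < 1 - t := by linarith
  refine le_q ?_ h1.le ?_
  · rw [div_le_one h2]
    linarith
  · have h3 : 1 - t / (1 - t) = (1 - 2 * t) / (1 - t) := by
      rw [eq_div_iff h2.ne', sub_mul, div_mul_cancel₀ _ h2.ne']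
      ring
    rw [h3, div_pow, le_div_iff₀ (by positivity)]
    have : 0 ≤ t ^ 3 * (2 - 3 * t) := mul_nonneg (by positivity) (by linarith)
    nlinarith

/-- A small Newton decrement bounds the distance to the centre. -/
theorem IsCentre.quad_sub_le (hw : IsCentre S w) (hx : x ∈ region S) {ρ : ℝ} (hρ0 : 0 < ρ)
    (hρ : ρ < 1 / 3) (hl : lam S x < ρ) : quad S x (w - x) ≤ q ρ ^ 2 := by
  -- With `∇F(w) = 0` and `r` the local distance from `x` to `w`, this and Cauchy–Schwarz give
  -- `r²/(1 + r) ≤ λ(x) r`, hence `r ≤ λ/(1 - λ)`.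
  have h1 := grad_sub_inner_ge hx (d := w - x) (by simpa using hw.1)
  have h2 := abs_inner_le hx (grad S x) (w - x)
  rw [add_sub_cancel, hw.grad_eq_zero, inner_zero_left] at h1
  have h3 : √(dual S x (grad S x)) < ρ := hl
  have hq := div_one_sub_le_q hρ0.le hρ
  have hq0 : 0 ≤ q ρ := q_nonneg hρ0.le hρ.le
  set r := √(quad S x (w - x))
  have hr2 : r ^ 2 = quad S x (w - x) := Real.sq_sqrt (quad_nonneg hx _)
  have hr0 : 0 ≤ r := Real.sqrt_nonneg _
  rw [← hr2] at h1 ⊢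
  refine pow_le_pow_left₀ hr0 (le_trans ?_ hq) 2
  rw [div_le_iff₀ (by positivity)] at h1
  rw [le_div_iff₀ (by linarith)]
  have h4 : -inner ℝ (grad S x) (w - x) ≤ ρ * r :=
    (neg_le_abs _).trans (h2.trans (by gcongr))
  rcases hr0.eq_or_lt with h | h
  · rw [← h]; linarith
  · have : r * r ≤ ρ * (1 + r) * r := by nlinarith
    have := le_of_mul_le_mul_right this h
    linarith

/-- The step has local length `λ/(1 + λ)` when damped and `λ < 2 - √3` otherwise. Both are below 1,
so it stays in the Dikin ellipsoid. -/
theorem newtonStep_mem (hx : x ∈ region S) : newtonStep S x ∈ region S := by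
  have hd := quad_hessInv hx (grad S x)
  have hl : lam S x ^ 2 = dual S x (grad S x) := Real.sq_sqrt (dual_nonneg hx _)
  have hl0 : 0 ≤ lam S x := Real.sqrt_nonneg _
  rw [newtonStep, sub_eq_add_neg]
  refine add_mem_region hx ?_
  rw [quad_neg, quad_smul, hd, ← hl, ← mul_pow]
  have h3 : 1 < √3 := by
    rw [Real.lt_sqrt zero_le_one]
    norm_num
  refine pow_lt_one₀ (by positivity) ?_ two_ne_zero
  split_ifs with h
  · rw [inv_mul_lt_iff₀ (by positivity)]
    linarith
  · linarith

theorem newtonStep_iterate_mem (hx : x ∈ region S) (i : ℕ) : (newtonStep S)^[i] x ∈ region S := by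
  induction i with
  | zero => exact hx
  | succ i ih =>
    rw [Function.iterate_succ_apply']
    exact newtonStep_mem ih

theorem Recentred.mem_region {c : Constants} {I : Problem n} {z z' : Vec n}
    (h : Recentred c I S z z') (hz : z ∈ region S) : z' ∈ region S := by
  obtain ⟨⟨i, rfl⟩, -⟩ := h
  exact newtonStep_iterate_mem hz i

end Centre

/-! ### Growth of the potential -/

section Growth

variable {n : ℕ} {S : Multiset (Cut n)} {e : Cut n} {z z' w w' : Vec n}

theorem potential_cons (S : Multiset (Cut n)) (e : Cut n) (x : Vec n) :
    potential (e ::ₘ S) x = potential S x - Real.log (e.slack x) + Real.log e.kap := by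
  simp [potential, barrier_cons]
  ring

/-- The barrier does not involve `κ`; this and its companions below carry facts across a reset of
`κ`. -/
theorem region_cons_congr {e f : Cut n} (ha : e.a = f.a) (hb : e.b = f.b) (S : Multiset (Cut n)) :
    region (e ::ₘ S) = region (f ::ₘ S) := by
  ext x
  simp [region, Cut.slack, ha, hb]

theorem barrier_cons_congr {e f : Cut n} (ha : e.a = f.a) (hb : e.b = f.b)
    (S : Multiset (Cut n)) : barrier (e ::ₘ S) = barrier (f ::ₘ S) := by
  ext x
  simp [barrier, Cut.slack, ha, hb]

theorem lam_cons_congr {e f : Cut n} (ha : e.a = f.a) (hb : e.b = f.b) (S : Multiset (Cut n)) :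
    lam (e ::ₘ S) = lam (f ::ₘ S) := by
  ext x
  simp [lam, grad, hessInv, hess, Cut.slack, ha, hb]

theorem isCentre_cons_congr {e f : Cut n} (ha : e.a = f.a) (hb : e.b = f.b)
    (S : Multiset (Cut n)) : IsCentre (e ::ₘ S) w ↔ IsCentre (f ::ₘ S) w := by
  rw [IsCentre, IsCentre, region_cons_congr ha hb, barrier_cons_congr ha hb]

variable {c : Constants}

theorem Constants.Admissible.zeta0_nonneg (hc : c.Admissible) : 0 ≤ c.zeta0 :=
  q_nonneg hc.rho0_pos.le hc.rho0_lt.le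

theorem Constants.Admissible.sigma_bound (hc : c.Admissible) :
    c.sigma0 / (1 - c.zeta0) ^ 4 < 1 / 10 := by
  have h1 := hc.C3_lt
  have h2 := hc.sigma0_lt
  -- With `s = σ₀/(1 - ζ₀)⁴`, the condition `C₃ < 1/3` reads `s/(1 - s) < 1/9`, that is `s < 1/10`.
  rw [Constants.C3, Real.sqrt_lt' (by norm_num), div_lt_iff₀ (by linarith)] at h1
  linarith

/-- The tangent at `r = 1/2`. Its slope `2/3` is what remains of `r` after the loss `r/3` in
`discard_growth`, and `ln(3/2)` is the gain there from `μ > 2`. -/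
theorem log_one_add_le {r : ℝ} (hr : 0 ≤ r) :
    Real.log (1 + r) ≤ Real.log (3 / 2) + 2 / 3 * r - 1 / 3 := by
  have h := Real.log_le_sub_one_of_pos (by positivity : 0 < (1 + r) / (3 / 2))
  rw [Real.log_div (by positivity) (by norm_num)] at h
  linarith

theorem discard_growth (hc : c.Admissible) (hz : z ∈ region (e ::ₘ S))
    (hl : lam (e ::ₘ S) z < c.rho0) (hk : 0 < e.kap) (hmu : 2 < e.mu z)
    (hsig : sigma (e ::ₘ S) e z < c.sigma0) (hw : IsCentre (e ::ₘ S) w) (hw' : IsCentre S w') :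
    potential (e ::ₘ S) w + 1 / 3 ≤ potential S w' := by
  have hζ0 := hc.zeta0_nonneg
  have hζ := hc.zeta0_lt
  have hs := hc.sigma_bound
  have hd : quad (e ::ₘ S) z (w - z) ≤ c.zeta0 ^ 2 :=
    hw.quad_sub_le hz hc.rho0_pos hc.rho0_lt hl
  set ζ := c.zeta0
  have hζ1 : 0 < 1 - ζ := by linarith
  obtain ⟨hze, hzS⟩ := mem_region_cons.1 hz
  obtain ⟨hwe, hwS⟩ := mem_region_cons.1 hw.1
  have ht : |inner ℝ e.a (w - z) / e.slack z| ≤ ζ :=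
    (abs_slack_ratio_le hz (Multiset.mem_cons_self e S) _).trans ((Real.sqrt_le_left hζ0).2 hd)
  have hsl : (1 - ζ) * e.slack z ≤ e.slack w := by
    have h1 := slack_add e hze (w - z)
    rw [add_sub_cancel] at h1
    rw [h1, mul_comm]
    gcongr
    linarith [neg_abs_le (inner ℝ e.a (w - z) / e.slack z)]
  have hdual : dual (e ::ₘ S) w e.a ≤ ((1 - ζ) ^ 2)⁻¹ * dual (e ::ₘ S) z e.a := by
    refine dual_le_of_quad_le hz hw.1 (by positivity) (fun v => ?_) e.a
    have := (quad_compare hz hζ0 (by linarith) hd v).1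
    rwa [add_sub_cancel, mul_comm, ← le_div_iff₀ (by positivity), div_eq_inv_mul] at this
  have hσ : dual (e ::ₘ S) w e.a ≤ 1 / 10 * e.slack w ^ 2 := by
    have h1 : dual (e ::ₘ S) z e.a ≤ c.sigma0 * e.slack z ^ 2 := by
      rw [← div_le_iff₀ (by positivity)]
      exact hsig.le
    have h2 : ((1 - ζ) * e.slack z) ^ 2 ≤ e.slack w ^ 2 := by gcongr
    have h3 := hc.sigma0_pos
    calc dual (e ::ₘ S) w e.a ≤ ((1 - ζ) ^ 2)⁻¹ * (c.sigma0 * e.slack z ^ 2) :=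
          hdual.trans (by gcongr)
      _ = c.sigma0 / (1 - ζ) ^ 4 * ((1 - ζ) * e.slack z) ^ 2 := by field_simp
      _ ≤ 1 / 10 * e.slack w ^ 2 := by gcongr
  have hb := barrier_add_ge hwS (d := w' - w) (by simpa using hw'.1)
  rw [add_sub_cancel] at hb
  have hg := inner_grad_cons S e w (w' - w)
  rw [hw.grad_eq_zero, inner_zero_left] at hg
  have hcs := inner_sq_le_dual_mul_quad hw.1 e.a (w' - w)
  rw [quad_cons] at hcs
  set r := √(quad S w (w' - w))
  have hr0 : 0 ≤ r := Real.sqrt_nonneg _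
  have hr2 : r ^ 2 = quad S w (w' - w) := Real.sq_sqrt (quad_nonneg hwS _)
  rw [← hr2] at hcs
  -- Cauchy–Schwarz in the norm that includes the dropped cut: `τ² ≤ (τ² + r²)/10`, and `τ²` is
  -- absorbed on the left.
  have hτ : |inner ℝ e.a (w' - w) / e.slack w| ≤ r / 3 := by
    refine abs_le_of_sq_le_sq ?_ (by positivity)
    set τ := inner ℝ e.a (w' - w) / e.slack w with hτ
    have h1 : inner ℝ e.a (w' - w) = τ * e.slack w := by
      rw [hτ]; field_simp
    rw [h1] at hcs
    have h2 : τ ^ 2 * e.slack w ^ 2 ≤ 1 / 10 * (τ ^ 2 + r ^ 2) * e.slack w ^ 2 := by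
      calc τ ^ 2 * e.slack w ^ 2 = (τ * e.slack w) ^ 2 := by ring
        _ ≤ dual (e ::ₘ S) w e.a * (τ ^ 2 + r ^ 2) := hcs
        _ ≤ 1 / 10 * e.slack w ^ 2 * (τ ^ 2 + r ^ 2) := by gcongr
        _ = _ := by ring
    have := le_of_mul_le_mul_right h2 (by positivity)
    nlinarith
  have hlog := log_one_add_le hr0
  have hmu' : Real.log (3 / 2) ≤ Real.log (e.slack w) - Real.log e.kap := by
    rw [← Real.log_div hwe.ne' hk.ne']
    refine Real.log_le_log (by norm_num) ?_
    rw [le_div_iff₀ hk]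
    rw [Cut.mu, lt_div_iff₀ hk] at hmu
    nlinarith
  rw [potential_cons]
  simp only [potential]
  linarith [neg_abs_le (inner ℝ e.a (w' - w) / e.slack w)]

theorem reset_growth (hk : 0 < e.kap) (hz : 0 < e.slack z) (hmu : 2 < e.mu z) (x : Vec n) :
    potential (e ::ₘ S) x + 1 / 3 ≤ potential (⟨e.a, e.b, e.slack z⟩ ::ₘ S) x := by
  rw [potential_cons, potential_cons]
  have h1 : Real.log 2 ≤ Real.log (e.slack z) - Real.log e.kap := by
    rw [← Real.log_div hz.ne' hk.ne']
    exact Real.log_le_log two_pos hmu.le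
  have h2 := Real.log_two_gt_d9
  simp only [Cut.slack] at h1 ⊢
  norm_num at h2
  linarith

theorem le_sub_log {x : ℝ} (h0 : 0 ≤ x) : x ^ 2 / 2 - x ^ 3 / 3 ≤ x - Real.log (1 + x) := by
  set f : ℝ → ℝ := fun t => t - Real.log (1 + t) - (t ^ 2 / 2 - t ^ 3 / 3) with hf
  have hd : ∀ t, 0 ≤ t → HasDerivAt f (1 - 1 / (1 + t) - (2 * t / 2 - 3 * t ^ 2 / 3)) t := by
    intro t ht
    have h1 := ((hasDerivAt_id t).const_add 1).log (by simp; linarith)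
    have h2 := ((hasDerivAt_pow 2 t).div_const 2).sub ((hasDerivAt_pow 3 t).div_const 3)
    have h3 := ((hasDerivAt_id t).sub h1).sub h2
    exact h3.congr_deriv (by simp)
  have hmono : MonotoneOn f (Set.Ici 0) := by
    refine monotoneOn_of_deriv_nonneg (convex_Ici 0)
      (fun t ht => (hd t ht).continuousAt.continuousWithinAt)
      (fun t ht => (hd t (interior_subset ht)).differentiableAt.differentiableWithinAt) ?_
    intro t ht
    have h0 : 0 ≤ t := interior_subset ht
    rw [(hd t h0).deriv]
    have : 1 - 1 / (1 + t) - (2 * t / 2 - 3 * t ^ 2 / 3) = t ^ 3 / (1 + t) := by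
      field_simp
      ring
    rw [this]
    positivity
  have := hmono Set.self_mem_Ici h0 h0
  simp [hf] at this
  linarith

theorem sub_log_mono {s r : ℝ} (hs : 0 ≤ s) (h : s ≤ r) :
    s - Real.log (1 + s) ≤ r - Real.log (1 + r) := by
  have h1 := Real.log_le_sub_one_of_pos (div_pos (by linarith : 0 < 1 + r) (by linarith : 0 < 1 + s))
  rw [Real.log_div (by linarith) (by linarith)] at h1
  have h2 : (1 + r) / (1 + s) ≤ 1 + (r - s) := by
    rw [div_le_iff₀ (by linarith)]
    nlinarith
  linarith

theorem C5_le_dist (hc : c.Admissible) (hz : z ∈ region S) (hl : lam S z < c.rho0)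
    (hez : 0 < e.slack z) (hγ : dual S z e.a / e.slack z ^ 2 = c.gamma0 ^ 2)
    (hw : IsCentre S w) (hw' : IsCentre (e ::ₘ S) w') : c.C5 ≤ √(quad S w (w' - w)) := by
  have hζ0 := hc.zeta0_nonneg
  have hζ := hc.zeta0_lt
  have hγ0 := hc.gamma0_pos
  have hC5 := hc.C5_lt
  have hd : quad S z (w - z) ≤ c.zeta0 ^ 2 := hw.quad_sub_le hz hc.rho0_pos hc.rho0_lt hl
  rw [Constants.C5] at hC5 ⊢
  set ζ := c.zeta0
  set γ := c.gamma0
  set r := √(quad S w (w' - w)) with hr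
  have hr0 : 0 ≤ r := Real.sqrt_nonneg _
  have hr2 : r ^ 2 = quad S w (w' - w) := Real.sq_sqrt (quad_nonneg hw.1 _)
  have hζ1 : 0 < 1 - ζ := by linarith
  by_contra! hlt
  have hr1 : r < 1 := hlt.trans hC5
  obtain ⟨hwe, hwS⟩ := mem_region_cons.1 hw'.1
  -- the gradient of the old barrier at the new centre is `a / s`
  have hA : (1 - r) * √(dual S w e.a) ≤ r * e.slack w' := by
    -- The test direction represents the gradient `a/s` in the Hessian metric at `w`, so the
    -- additive bound becomes `‖a/s‖* ≤ r/(1 - r)`.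
    have h1 := grad_sub_inner_le hw.1 hr0 hr1 hr2.ge ((e.slack w')⁻¹ • hessInv S w e.a)
    rw [add_sub_cancel, hw.grad_eq_zero, inner_zero_left, quad_smul, quad_hessInv hw.1,
      ← hr2] at h1
    have h2 := inner_grad_cons S e w' ((e.slack w')⁻¹ • hessInv S w e.a)
    rw [hw'.grad_eq_zero, inner_zero_left, inner_smul_right, inner_smul_right,
      show inner ℝ e.a (hessInv S w e.a) = dual S w e.a from rfl] at h2
    rw [inner_smul_right] at h1
    have h3 : (e.slack w')⁻¹ ^ 2 * dual S w e.a ≤ r ^ 2 / (1 - r) ^ 2 := by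
      have : (e.slack w')⁻¹ * dual S w e.a / e.slack w' = (e.slack w')⁻¹ ^ 2 * dual S w e.a := by
        ring
      linarith
    rw [le_div_iff₀ (by nlinarith), inv_pow, inv_mul_eq_div, div_mul_eq_mul_div,
      div_le_iff₀ (by positivity)] at h3
    refine le_of_sq_le_sq ?_ (by positivity)
    rw [mul_pow, mul_pow, Real.sq_sqrt (dual_nonneg hw.1 _)]
    linarith
  have hdz : √(dual S z e.a) = γ * e.slack z := by
    rw [div_eq_iff (by positivity)] at hγ
    rw [hγ, ← mul_pow, Real.sqrt_sq (by positivity)]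
  have hB : (1 - ζ) * (γ * e.slack z) ≤ √(dual S w e.a) := by
    have : dual S z e.a ≤ ((1 - ζ) ^ 2)⁻¹ * dual S w e.a := by
      refine dual_le_of_quad_le hw.1 hz (by positivity) (fun v => ?_) e.a
      have := (quad_compare hz hζ0 (by linarith) hd v).2
      rwa [add_sub_cancel, mul_comm, ← le_div_iff₀ (by positivity), div_eq_inv_mul] at this
    rw [← hdz]
    refine Real.le_sqrt_of_sq_le ?_
    rw [mul_pow, Real.sq_sqrt (dual_nonneg hz _)]
    rwa [← div_eq_inv_mul, le_div_iff₀ (by positivity), mul_comm] at this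
  have hC : e.slack w' ≤ e.slack z * (1 + γ * (ζ + r / (1 - ζ))) := by
    have h1 : √(quad S z (w' - w)) ≤ r / (1 - ζ) := by
      have := (quad_compare hz hζ0 (by linarith) hd (w' - w)).1
      rw [add_sub_cancel, ← hr2] at this
      refine Real.sqrt_le_iff.2 ⟨by positivity, ?_⟩
      rw [div_pow, le_div_iff₀ (by positivity)]
      linarith
    have h2 : √(quad S z (w' - z)) ≤ ζ + r / (1 - ζ) := by
      have := sqrt_quad_add_le hz (w - z) (w' - w)
      rw [show w - z + (w' - w) = w' - z by abel] at this
      have h3 : √(quad S z (w - z)) ≤ ζ := (Real.sqrt_le_left hζ0).2 hd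
      linarith
    have h3 := abs_inner_le hz e.a (w' - z)
    rw [hdz] at h3
    have h4 : e.slack w' = e.slack z + inner ℝ e.a (w' - z) := by
      simp [Cut.slack, inner_sub_right]
    calc e.slack w' ≤ e.slack z + γ * e.slack z * √(quad S z (w' - z)) := by
          rw [h4]
          linarith [le_abs_self (inner ℝ e.a (w' - z))]
      _ ≤ e.slack z + γ * e.slack z * (ζ + r / (1 - ζ)) := by gcongr
      _ = _ := by ring
  -- The dual norm of `a` at `w` is bounded below through `γ₀` (`hB`) and above through the slack at
  -- `w'` (`hA`, `hC`). The resulting inequality in `r` fails for `r < C₅`.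
  have hD : (1 - r) * ((1 - ζ) * γ) ≤ r * (1 + γ * (ζ + r / (1 - ζ))) := by
    refine le_of_mul_le_mul_right ?_ hez
    calc (1 - r) * ((1 - ζ) * γ) * e.slack z = (1 - r) * ((1 - ζ) * (γ * e.slack z)) := by ring
      _ ≤ (1 - r) * √(dual S w e.a) := by
          have : 0 ≤ 1 - r := by linarith
          gcongr
      _ ≤ r * e.slack w' := hA
      _ ≤ r * (e.slack z * (1 + γ * (ζ + r / (1 - ζ)))) := by gcongr
      _ = _ := by ring
  rw [lt_div_iff₀ (by positivity)] at hlt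
  have hγi : γ * (1 / γ) = 1 := by field_simp
  have hγi0 : 0 < 1 / γ := by positivity
  have hE : r * (1 + γ * (2 + ζ)) < γ * (1 - ζ) := by
    have := mul_lt_mul_of_pos_left hlt hγ0
    nlinarith
  have hF : r / (1 - ζ) ≤ 1 / 2 := by
    rw [div_le_iff₀ hζ1]
    nlinarith
  have hG : r * (1 + γ * (ζ + r / (1 - ζ))) ≤ r * (1 + γ * (ζ + 1 / 2)) := by gcongr
  nlinarith [mul_nonneg hr0 hγ0.le, mul_nonneg (mul_nonneg hr0 hγ0.le) hζ0]

theorem add_growth (hc : c.Admissible) (hz : z ∈ region S) (hl : lam S z < c.rho0)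
    (hez : 0 < e.slack z) (hγ : dual S z e.a / e.slack z ^ 2 = c.gamma0 ^ 2)
    (hz' : z' ∈ region (e ::ₘ S)) (hl' : lam (e ::ₘ S) z' < c.rho0) (hk : e.kap = e.slack z')
    (hw : IsCentre S w) (hw' : IsCentre (e ::ₘ S) w') :
    potential S w + (c.C6 - c.zeta0) ≤ potential (e ::ₘ S) w' := by
  have hζ0 := hc.zeta0_nonneg
  have hC5 := hc.C5_lt
  have hC50 : 0 ≤ c.C5 := by
    have := hc.zeta0_lt
    have := hc.gamma0_pos
    unfold Constants.C5
    exact div_nonneg (by linarith) (by positivity)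
  have hr := C5_le_dist hc hz hl hez hγ hw hw'
  obtain ⟨hwe, hwS⟩ := mem_region_cons.1 hw'.1
  have h1 := hw.barrier_ge hwS
  have h2 := sub_log_mono hC50 hr
  have h3 := le_sub_log hC50
  -- `C₆` subtracts the larger cubic term, so it lies below `C₅²/2 - C₅³/3`, the lower bound for `C₅
  -- - ln(1 + C₅)`.
  have h4 : c.C5 ^ 3 / 3 ≤ c.C5 ^ 3 / (3 * (1 - c.C5)) := by
    have : 0 < 1 - c.C5 := by linarith
    gcongr
    linarith
  have hd : quad (e ::ₘ S) z' (w' - z') ≤ c.zeta0 ^ 2 :=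
    hw'.quad_sub_le hz' hc.rho0_pos hc.rho0_lt hl'
  have ht : |inner ℝ e.a (w' - z') / e.slack z'| ≤ c.zeta0 :=
    (abs_slack_ratio_le hz' (Multiset.mem_cons_self e S) _).trans ((Real.sqrt_le_left hζ0).2 hd)
  have hez' := (mem_region_cons.1 hz').1
  have h5 : Real.log (e.slack w') ≤ Real.log (e.slack z') + c.zeta0 := by
    have h6 := slack_add e hez' (w' - z')
    rw [add_sub_cancel] at h6
    have h7 : 0 < 1 + inner ℝ e.a (w' - z') / e.slack z' := by
      rw [h6] at hwe
      exact pos_of_mul_pos_right hwe hez'.le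
    rw [h6, Real.log_mul hez'.ne' h7.ne']
    have := Real.log_le_sub_one_of_pos h7
    linarith [le_abs_self (inner ℝ e.a (w' - z') / e.slack z')]
  rw [potential_cons, hk]
  simp only [potential, Constants.C6]
  linarith

end Growth

/-! ### The initial state -/

section Initial

variable {n : ℕ} {I : Problem n}

theorem initial_spec (hp : I.p ≠ 0) : (initial I).z ∈ region (initial I).cuts ∧
    lam (initial I).cuts (initial I).z = 0 := by
  have ha : ‖‖I.p‖⁻¹ • I.p‖ = 1 := norm_smul_inv_norm hp
  simp only [initial]
  generalize ‖I.p‖⁻¹ • I.p = a at ha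
  have h3 : 0 < √3 := by positivity
  have h3' : √3 ^ 2 = 3 := Real.sq_sqrt (by norm_num)
  have hin : inner ℝ a ((1 / √3) • a) = 1 / √3 := by
    rw [inner_smul_right, real_inner_self_eq_norm_sq, ha]
    simp
  have hn : ‖(1 / √3) • a‖ = 1 / √3 := by
    rw [norm_smul, ha, mul_one, Real.norm_of_nonneg (by positivity)]
  have hlt : 1 / √3 < 1 := by
    rw [div_lt_one h3, Real.lt_sqrt zero_le_one]
    norm_num
  refine ⟨⟨?_, ?_⟩, ?_⟩
  · rwa [hn]
  · intro e he
    rw [Multiset.mem_singleton] at he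
    subst he
    simp only [Cut.slack, hin, sub_zero]
    positivity
  -- The starting point is the exact centre: `-√3 + (2/(1 - 1/3))/√3 = 0`.
  · have hg : grad {⟨a, 0, 1 / √3⟩} ((1 / √3) • a) = 0 := by
      simp only [grad, Multiset.map_singleton, Multiset.sum_singleton, Cut.slack, hin, hn,
        sub_zero, smul_smul, ← neg_smul, ← add_smul]
      convert zero_smul ℝ a
      rw [div_pow, h3']
      field_simp
      linarith
    rw [lam, hg, inner_zero_left, Real.sqrt_zero]

theorem initial_potential_nonneg (hp : I.p ≠ 0) {x : Vec n} (hx : x ∈ region (initial I).cuts) :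
    0 ≤ potential (initial I).cuts x := by
  have ha : ‖‖I.p‖⁻¹ • I.p‖ = 1 := norm_smul_inv_norm hp
  obtain ⟨h1, h2⟩ := hx
  have hw := one_sub_norm_sq_pos h1
  have ht := h2 _ (Multiset.mem_singleton_self _)
  have hle : inner ℝ (‖I.p‖⁻¹ • I.p) x ≤ ‖x‖ := by
    have := real_inner_le_norm (‖I.p‖⁻¹ • I.p) x
    rwa [ha, one_mul] at this
  simp only [Cut.slack, sub_zero] at ht
  simp only [potential, barrier, initial, Multiset.map_singleton, Multiset.sum_singleton, Cut.slack,
    sub_zero]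
  set t := inner ℝ (‖I.p‖⁻¹ • I.p) x
  -- Nonnegativity amounts to `t(1 - ‖x‖²) ≤ 1/√3`; since `t ≤ ‖x‖`, the crude bound `1/2` for
  -- `‖x‖(1 - ‖x‖²)` is enough.
  have h3 : 1 / 2 ≤ 1 / √3 := by
    gcongr
    rw [Real.sqrt_le_left two_pos.le]
    norm_num
  have h4 : t * (1 - ‖x‖ ^ 2) ≤ 1 / √3 := by
    refine le_trans ?_ h3
    have : t * (1 - ‖x‖ ^ 2) ≤ ‖x‖ * (1 - ‖x‖ ^ 2) := by gcongr
    nlinarith [norm_nonneg x, sq_nonneg (‖x‖ - 1 / 2), mul_nonneg (norm_nonneg x)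
      (sq_nonneg (‖x‖ - 1 / 2))]
  have h5 := Real.log_le_log (by positivity) h4
  rw [Real.log_mul ht.ne' hw.ne'] at h5
  linarith

end Initial

/-! ### Runs of the algorithm -/

/-- The new normal is orthogonal to `z`, so the slack of the new cut at `z` is `-β > 0`: the old
point stays feasible and recentring can start there. -/
theorem inner_abar {n : ℕ} (p k z : Vec n) : inner ℝ (abar p k (‖z‖⁻¹ • z)) z = 0 := by
  by_cases hz : z = 0
  · simp [hz]
  · have : ‖z‖ ≠ 0 := by simpa using hz
    simp only [abar, inner_sub_left, inner_smul_left, real_inner_self_eq_norm_sq]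
    simp only [inner_sub_right, real_inner_comm z]
    simp
    field_simp
    ring

/-- What holds after `i` iterations. -/
structure Invariant {n : ℕ} (c : Constants) (θ : ℝ) (i : ℕ) (s : State n) : Prop where
  mem : s.z ∈ region s.cuts
  lam_lt : lam s.cuts s.z < c.rho0
  kap_pos : ∀ e ∈ s.cuts, 0 < e.kap
  le_potential : ∀ w, IsCentre s.cuts w → θ * i ≤ potential s.cuts w

theorem Invariant.step {n : ℕ} {c : Constants} (hc : c.Admissible) {θ : ℝ} (h1 : θ ≤ 1 / 3)
    (h2 : θ ≤ c.C6 - c.zeta0) {I : Problem n} {i : ℕ} {s s' : State n} (hs : Invariant c θ i s)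
    (h : Iteration c I s s') : Invariant c θ (i + 1) s' := by
  obtain ⟨hz, hl, hk, hpot⟩ := hs
  obtain ⟨w, hw⟩ := exists_isCentre hz
  have hpw := hpot w hw
  rcases h with ⟨e, he, hmu, hsig, hrec⟩ | ⟨-, e, T, he, hmu, hs', hz'⟩ |
    ⟨-, v, k, a, be, rfl, -, -, -, ha, hbe, hγ, hs', hrec⟩
  · rw [he] at hz hl hk hw hpw hsig
    refine ⟨hrec.mem_region (mem_region_cons.1 hz).2, hrec.2.1,
      fun f hf => hk f (Multiset.mem_cons_of_mem hf), fun w' hw' => ?_⟩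
    have := discard_growth hc hz hl (hk e (Multiset.mem_cons_self _ _)) hmu hsig hw hw'
    push_cast
    linarith
  · rw [he] at hz hl hk hw hpw
    have hke := hk e (Multiset.mem_cons_self _ _)
    have hze := (mem_region_cons.1 hz).1
    refine ⟨?_, ?_, ?_, ?_⟩ <;> rw [hs']
    · rw [hz', region_cons_congr (e := ⟨e.a, e.b, e.slack s.z⟩) (f := e) rfl rfl]
      exact hz
    · rw [hz', lam_cons_congr (e := ⟨e.a, e.b, e.slack s.z⟩) (f := e) rfl rfl]
      exact hl
    · intro f hf
      rcases Multiset.mem_cons.1 hf with rfl | hf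
      · exact hze
      · exact hk f (Multiset.mem_cons_of_mem hf)
    · intro w' hw'
      -- A reset leaves the barrier alone, so the centre does not move and only the `ln κ` term
      -- changes.
      have hww : w' = w := hw.unique ((isCentre_cons_congr
        (e := ⟨e.a, e.b, e.slack s.z⟩) (f := e) rfl rfl T).1 hw')
      subst hww
      have := reset_growth (S := T) hke hze hmu w'
      push_cast
      linarith
  · have haz : inner ℝ a s.z = 0 := by
      rw [ha, inner_smul_left, inner_abar, mul_zero]
    set e : Cut n := ⟨a, be, inner ℝ a s'.z - be⟩ with he
    have hez : 0 < e.slack s.z := by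
      simp only [Cut.slack, he, haz]
      linarith
    rw [hs'] at hrec
    have hz' : s'.z ∈ region (e ::ₘ s.cuts) := hrec.mem_region (mem_region_cons.2 ⟨hez, hz⟩)
    have hez' := (mem_region_cons.1 hz').1
    refine ⟨?_, ?_, ?_, ?_⟩ <;> rw [hs']
    · exact hz'
    · exact hrec.2.1
    · intro f hf
      rcases Multiset.mem_cons.1 hf with rfl | hf
      · exact hez'
      · exact hk f hf
    · intro w' hw'
      have := add_growth hc hz hl hez hγ hz' hrec.2.1 rfl hw hw'
      push_cast
      linarith

theorem Reaches.invariant {n : ℕ} {c : Constants} (hc : c.Admissible) {θ : ℝ} (h1 : θ ≤ 1 / 3)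
    (h2 : θ ≤ c.C6 - c.zeta0) {I : Problem n} (hp : I.p ≠ 0) {i : ℕ} {s : State n}
    (h : Reaches c I i s) : Invariant c θ i s := by
  induction h with
  | init =>
    obtain ⟨hz, hl⟩ := initial_spec hp
    refine ⟨hz, hl ▸ hc.rho0_pos, fun e he => ?_, fun w hw => ?_⟩
    · simp only [initial, Multiset.mem_singleton] at he
      subst he
      positivity
    · simpa using initial_potential_nonneg hp hw.1
  | iterate _ _ hi ih => exact ih.step hc h1 h2 hi

end AnalyticCentre

theorem mainTheorem4 (c : AnalyticCentre.Constants) (hc : c.Admissible) :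
    ∃ θ : ℝ, 0 < θ ∧
      ∀ (n : ℕ) (I : AnalyticCentre.Problem n) (R : ℝ),
        Convex ℝ I.K → (∃ ρ : ℝ, 0 < ρ ∧ Metric.closedBall 0 ρ ⊆ I.K) →
        I.K ⊆ Metric.closedBall 0 R → I.p ≠ 0 → 0 < I.del → 0 < I.delTilde →
        ∀ (ι : ℕ) (s : AnalyticCentre.State n), AnalyticCentre.Reaches c I ι s →
          (∃! ω : AnalyticCentre.Vec n, AnalyticCentre.IsCentre s.cuts ω) ∧
          ∀ ω : AnalyticCentre.Vec n, AnalyticCentre.IsCentre s.cuts ω →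
            θ * ι ≤ AnalyticCentre.potential s.cuts ω := by
  have h6 := hc.C6_gt
  -- `1/3` is the gain guaranteed by a discard or a reset, `C₆ - ζ₀` the gain guaranteed by an added
  -- cut.
  refine ⟨min (1 / 3) (c.C6 - c.zeta0), lt_min (by norm_num) (by linarith), ?_⟩
  intro n I R _ _ _ hp _ _ ι s hs
  have h := hs.invariant hc (min_le_left _ _) (min_le_right _ _) hp
  obtain ⟨w, hw⟩ := AnalyticCentre.exists_isCentre h.mem
  exact ⟨⟨w, hw, fun v hv => hw.unique hv⟩, h.le_potential⟩
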